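/- **Conventions.** A symmetric $C$-coloured operad $\mathcal O$ in $\mathbf{Set}$ consists of a set $C$ of colours, sets of operations $\mathcal O(c_1,\dots,c_n;d)$ for all $n\ge 0$ and $c_i,d\in C$, actions of the symmetric groups, units and a composition product that is associative, unital and equivariant. A morphism $f\colon\mathcal O\to\mathcal P$ consists of a function $f$ on colours and functions $\mathcal O(c_1,\dots,c_n;d)\to\mathcal P(f(c_1),\dots,f(c_n);f(d))$ that respect this structure. An $\mathcal O$-algebra is a family of sets $X=(X_c)_{c\in C}$ with associative, unital and equivariant actions $\mathcal O(c_1,\dots,c_n;d)\times X_{c_1}\times\dots\times X_{c_n}\to X_d$; morphisms of algebras are families of maps that commute with the actions. This gives the category $\mathrm{Alg}(\mathcal O)$, and a morphism $f\colon\mathcal O\to\mathcal P$ gives the restriction functor $f^*\colon \mathrm{Alg}(\mathcal P)\to\mathrm{Alg}(\mathcal O)$, $(f^*X)_c=X_{f(c)}$. The underlying category $j^*\mathcal O$ has the colours as objects, and $j^*\mathcal O(c,d)=\mathcal O(c;d)$. A functor $F\colon\mathcal A\to\mathcal B$ is *essentially surjective up to retracts* if every object of $\mathcal B$ is a retract of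 $F(a)$ for some object $a$ of $\mathcal A$. The morphism $f$ is a *Morita equivalence of operads* if all functions $\mathcal O(c_1,\dots,c_n;d)\to\mathcal P(f(c_1),\dots,f(c_n);f(d))$ are bijective and $j^*(f)$ is essentially surjective up to retracts. An *$S$-sorted algebraic theory* is a small category with finite products whose objects are the finite sequences in the set $S$ and in which the concatenation $\mathbf a\mathbf b$ is isomorphic to $\mathbf a\times\mathbf b$; a morphism of such theories is a function on sorts together with a finite product preserving functor that extends it on one-term sequences. It is a *Morita equivalence of algebraic theories* if its functor is fully faithful and essentially surjective up to retracts. The theory $\mathbb T(\mathcal O)$ of a $C$-coloured operad $\mathcal O$ is the $C$-sorted theory with $$\mathbb T(\mathcal O)(\mathbf c,\mathbf d)=\prod_{i=1}^{|\mathbf d|}(p_!\mathcal O)(\mathbf c;d_i),\qquad (p_!\mathcal O)(\mathbf c;d)=\Big(\coprod_{m\ge 0}\ \coprod_{\alpha\colon\{1,\dots,m\}\to\{1,\dots,|\mathbf c|\}}\mathcal O(c_{\alpha(1)},\dots,c_{\alpha(m)};d)\Big)\Big/\!\sim ,$$ where $\sim$ identifies elements that differ by a permutation of $\{1,\dots,m\}$,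 and with composition induced by substitution in $\mathcal O$. A morphism $f$ of operads induces a morphism $\mathbb T(f)$ of theories. **Theorem.** Let $f\colon\mathcal O\to\mathcal P$ be a morphism of symmetric coloured operads in $\mathbf{Set}$. Then $f^*\colon \mathrm{Alg}(\mathcal P)\to\mathrm{Alg}(\mathcal O)$ has a left adjoint $f_!$, and the following are equivalent: 1. The morphism $f$ is a Morita equivalence of operads. 2. The morphism $\mathbb T(f)\colon\mathbb T(\mathcal O)\to\mathbb T(\mathcal P)$ is a Morita equivalence of algebraic theories. 3. The induced adjunction $f_!\colon\mathrm{Alg}(\mathcal O)\rightleftarrows\mathrm{Alg}(\mathcal P)\colon f^*$ is an equivalence of categories, that is, its unit and counit are isomorphisms. -/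

import Mathlib

universe u

open CategoryTheory CategoryTheory.Limits

namespace ColouredOperad

/-! ### Finite sequences of colours -/

/-- A finite sequence of elements of `C`. -/
@[ext]
structure Word (C : Type u) where
  len : ℕ
  get : Fin len → C

namespace Word

variable {C : Type u} {D : Type u}

/-- The sequence with the single entry `c`. -/
def single (c : C) : Word C := ⟨1, fun _ => c⟩

/-- The empty sequence. -/
def empty : Word C := ⟨0, Fin.elim0⟩

/-- Concatenation of two sequences. -/
def append (a b : Word C) : Word C := ⟨a.len + b.len, Fin.append a.get b.get⟩

/-- The sequence `c ∘ α`. -/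
def reindex (c : Word C) {m : ℕ} (α : Fin m → Fin c.len) : Word C := ⟨m, fun i => c.get (α i)⟩

/-- Entrywise application of a function. -/
def map (φ : C → D) (c : Word C) : Word D := ⟨c.len, fun i => φ (c.get i)⟩

/-- The concatenation `b₀ b₁ ⋯ bₙ₋₁` of a finite sequence of sequences. -/
def join {n : ℕ} (b : Fin n → Word C) : Word C :=
  ⟨∑ i, (b i).len, fun x =>
    (b (finSigmaFinEquiv.symm x).1).get (finSigmaFinEquiv.symm x).2⟩

/-- A position in the concatenation is a position in one of the pieces
(in lexicographic order). -/
def split {n : ℕ} (b : Fin n → Word C) : Fin (join b).len ≃ (Σ i, Fin (b i).len) :=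
  finSigmaFinEquiv.symm

theorem get_split_symm {n : ℕ} (b : Fin n → Word C) (p : Σ i, Fin (b i).len) :
    (join b).get ((split b).symm p) = (b p.1).get p.2 :=
  congrArg (fun q : (Σ i, Fin (b i).len) => (b q.1).get q.2) ((split b).apply_symm_apply p)

/-- A morphism `b ⟶ c` in the groupoid of finite sequences of colours: a bijection
between the positions that respects the colours. -/
@[ext]
structure Perm (b c : Word C) where
  equiv : Fin b.len ≃ Fin c.len
  comm : ∀ i, c.get (equiv i) = b.get i

namespace Perm

/-- The identity. -/
def refl (b : Word C) : Perm b b := ⟨Equiv.refl _, fun _ => rfl⟩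

/-- Composition (first `σ`, then `τ`). -/
def trans {a b c : Word C} (σ : Perm a b) (τ : Perm b c) : Perm a c :=
  ⟨σ.equiv.trans τ.equiv, fun i => (τ.comm _).trans (σ.comm i)⟩

/-- The image of a morphism under a function between the sets of colours. -/
def map (φ : C → D) {b c : Word C} (σ : Perm b c) : Perm (b.map φ) (c.map φ) :=
  ⟨σ.equiv, fun i => congrArg φ (σ.comm i)⟩

/-- The bijection `σ`, as a morphism `c ∘ σ ⟶ c`. -/
def reindex (c : Word C) {m : ℕ} (σ : Fin m ≃ Fin c.len) : Perm (c.reindex σ) c :=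
  ⟨σ, fun _ => rfl⟩

/-- The concatenation of a one-term sequence of sequences is its only term. -/
def joinSingle (b : Word C) : Perm (join (fun _ : Fin 1 => b)) b :=
  ⟨(split _).trans ((Equiv.sigmaEquivProd _ _).trans (Equiv.uniqueProd _ _)), fun _ => rfl⟩

/-- The concatenation of the one-term sequences `c₀`, …, `cₙ₋₁` is `c`. -/
def joinSingles (c : Word C) : Perm (join (fun i => single (c.get i))) c :=
  ⟨(split _).trans ((Equiv.sigmaEquivProd _ _).trans (Equiv.prodUnique _ (Fin 1))),
    fun _ => rfl⟩

/-- Associativity of concatenation. -/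
def joinAssoc {n : ℕ} (b : Fin n → Word C) (a : ∀ i, Fin (b i).len → Word C) :
    Perm (join fun x : Fin (join b).len => a (split b x).1 (split b x).2)
      (join fun i => join (a i)) where
  equiv := (split _).trans <|
    (Equiv.sigmaCongrLeft (β := fun p : (Σ i, Fin (b i).len) => Fin (a p.1 p.2).len)
      (split b)).trans <|
    (Equiv.sigmaAssoc (fun i (j : Fin (b i).len) => Fin (a i j).len)).trans <|
    (Equiv.sigmaCongrRight fun i => (split (a i)).symm).trans (split _).symm
  comm _ := (get_split_symm _ _).trans (get_split_symm _ _)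

/-- Side by side juxtaposition of bijections. -/
def joinCongr {n : ℕ} {b b' : Fin n → Word C} (τ : ∀ i, Perm (b i) (b' i)) :
    Perm (join b) (join b') where
  equiv := (split b).trans ((Equiv.sigmaCongrRight fun i => (τ i).equiv).trans (split b').symm)
  comm _ := (get_split_symm _ _).trans ((τ _).comm _)

/-- The block permutation that is induced by a bijection between the index sets. -/
def joinReindex {m n : ℕ} (σ : Fin m ≃ Fin n) (b : Fin n → Word C) :
    Perm (join fun i => b (σ i)) (join b) where
  equiv := (split _).trans
    ((Equiv.sigmaCongrLeft (β := fun i => Fin (b i).len) σ).trans (split b).symm)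
  comm _ := get_split_symm _ _

end Perm

end Word

/-! ### Symmetric coloured operads in sets -/

/-- A symmetric `C`-coloured operad in sets: sets of operations `Op c d` with inputs
`c = (c₁, …, cₙ)` and output `d`, functorial in `c` for the groupoid of finite sequences
in `C`, with units and an associative, unital and equivariant composition product. -/
structure SymOperad (C : Type u) where
  Op : Word C → C → Type u
  act : ∀ {b c : Word C} {d : C}, Word.Perm b c → Op b d → Op c d
  act_refl : ∀ {c : Word C} {d : C} (o : Op c d), act (Word.Perm.refl c) o = o
  act_trans : ∀ {a b c : Word C} {d : C} (σ : Word.Perm a b) (τ : Word.Perm b c) (o : Op a d),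
    act (σ.trans τ) o = act τ (act σ o)
  one : ∀ c : C, Op (Word.single c) c
  comp : ∀ {c : Word C} {d : C}, Op c d → ∀ {b : Fin c.len → Word C},
    (∀ i, Op (b i) (c.get i)) → Op (Word.join b) d
  one_comp : ∀ {b : Word C} {d : C} (q : Op b d),
    act (Word.Perm.joinSingle b) (comp (one d) (b := fun _ => b) (fun _ => q)) = q
  comp_one : ∀ {c : Word C} {d : C} (o : Op c d),
    act (Word.Perm.joinSingles c) (comp o fun i => one (c.get i)) = o
  comp_assoc : ∀ {c : Word C} {d : C} (o : Op c d) {b : Fin c.len → Word C}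
    (q : ∀ i, Op (b i) (c.get i)) {a : ∀ i, Fin (b i).len → Word C}
    (r : ∀ i (j : Fin (b i).len), Op (a i j) ((b i).get j)),
    act (Word.Perm.joinAssoc b a)
      (comp (comp o q) (b := fun x => a (Word.split b x).1 (Word.split b x).2)
        (fun x => r (Word.split b x).1 (Word.split b x).2)) =
      comp o fun i => comp (q i) (r i)
  comp_act : ∀ {c : Word C} {d : C} (o : Op c d) {b b' : Fin c.len → Word C}
    (τ : ∀ i, Word.Perm (b i) (b' i)) (q : ∀ i, Op (b i) (c.get i)),
    comp o (fun i => act (τ i) (q i)) = act (Word.Perm.joinCongr τ) (comp o q)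
  act_comp : ∀ {c : Word C} {d : C} {m : ℕ} (σ : Fin m ≃ Fin c.len) (o : Op (c.reindex σ) d)
    {b : Fin c.len → Word C} (q : ∀ i, Op (b i) (c.get i)),
    comp (act (Word.Perm.reindex c σ) o) q =
      act (Word.Perm.joinReindex σ b)
        (comp o (b := fun i : Fin m => b (σ i)) (fun i : Fin m => q (σ i)))

namespace SymOperad

variable {C D : Type u}

/-- A morphism from a `C`-coloured operad to a `D`-coloured operad: a function on colours
and compatible functions on operations that respect all the structure. -/
structure Hom (O : SymOperad C) (P : SymOperad D) where
  onColour : C → D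
  onOp : ∀ {c : Word C} {d : C}, O.Op c d → P.Op (c.map onColour) (onColour d)
  onOp_act : ∀ {b c : Word C} {d : C} (σ : Word.Perm b c) (o : O.Op b d),
    onOp (O.act σ o) = P.act (σ.map onColour) (onOp o)
  onOp_one : ∀ c : C, onOp (O.one c) = P.one (onColour c)
  onOp_comp : ∀ {c : Word C} {d : C} (o : O.Op c d) {b : Fin c.len → Word C}
    (q : ∀ i, O.Op (b i) (c.get i)),
    onOp (O.comp o q) = P.comp (onOp o) (b := fun i => (b i).map onColour) (fun i => onOp (q i))

/-! ### The underlying category of unary operations -/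

/-- The type of objects of the underlying category `j^* O`: the colours. -/
def Underlying (_O : SymOperad C) : Type u := C

/-- Composition of unary operations. -/
def comp₁ (O : SymOperad C) {a b c : C} (f : O.Op (Word.single a) b)
    (g : O.Op (Word.single b) c) : O.Op (Word.single a) c :=
  O.act (Word.Perm.joinSingle (Word.single a))
    (O.comp g (b := fun _ => Word.single a) (fun _ => f))

theorem comp₁_one (O : SymOperad C) {a b : C} (f : O.Op (Word.single a) b) :
    O.comp₁ f (O.one b) = f :=
  O.one_comp f

theorem one_comp₁ (O : SymOperad C) {a b : C} (f : O.Op (Word.single a) b) :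
    O.comp₁ (O.one a) f = f := by
  have h : Word.Perm.joinSingle (Word.single a) = Word.Perm.joinSingles (Word.single a) := by
    apply Word.Perm.ext
    apply Equiv.ext
    intro x
    exact Subsingleton.elim (α := Fin 1) _ _
  unfold comp₁
  rw [h]
  exact O.comp_one f

theorem comp₁_assoc (O : SymOperad C) {a b c d : C} (f : O.Op (Word.single a) b)
    (g : O.Op (Word.single b) c) (h : O.Op (Word.single c) d) :
    O.comp₁ (O.comp₁ f g) h = O.comp₁ f (O.comp₁ g h) := by
  let w : Word C := Word.join (fun _ : Fin 1 => Word.single b)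
  let σ : Fin w.len ≃ Fin (Word.single b).len :=
    (Word.Perm.joinSingle (Word.single b)).equiv
  have h1 := O.comp_assoc h (b := fun _ => Word.single b) (fun _ => g)
    (a := fun _ _ => Word.single a) (fun _ _ => f)
  have h2 := O.comp_act h
    (b := fun _ => Word.join (fun _ : Fin (Word.single b).len => Word.single a))
    (fun _ => Word.Perm.joinSingle (Word.single a)) (fun _ => O.comp g (fun _ => f))
  have h3 := O.act_comp (c := Word.single b) (d := d) (m := w.len) σ
    (O.comp h (b := fun _ => Word.single b) (fun _ => g))
    (b := fun _ => Word.single a) (fun _ => f)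
  have e1 : O.comp₁ (O.comp₁ f g) h = O.act (Word.Perm.joinSingle (Word.single a))
      (O.comp h (fun _ => O.act (Word.Perm.joinSingle (Word.single a))
        (O.comp g (fun _ => f)))) := rfl
  have e2 : O.comp₁ f (O.comp₁ g h) = O.act (Word.Perm.joinSingle (Word.single a))
      (O.comp (c := Word.single b) (O.act (Word.Perm.reindex (Word.single b) σ)
        (O.comp h (b := fun _ => Word.single b) (fun _ => g)))
        (b := fun _ => Word.single a) (fun _ => f)) := rfl
  refine e1.trans (Eq.trans ?_ e2.symm)
  refine (congrArg (O.act _) (h2.trans (congrArg (O.act _) h1.symm))).trans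
    (Eq.trans ?_ (congrArg (O.act _) h3.symm))
  refine (congrArg (O.act _) (O.act_trans _ _ _).symm).trans ?_
  refine (O.act_trans _ _ _).symm.trans (Eq.trans ?_ (O.act_trans _ _ _))
  refine congrArg (fun τ => O.act τ _) ?_
  apply Word.Perm.ext
  apply Equiv.ext
  intro x
  exact Subsingleton.elim (α := Fin 1) _ _

instance (O : SymOperad C) : Category.{u} O.Underlying where
  Hom c d := O.Op (Word.single c) d
  id c := O.one c
  comp f g := O.comp₁ f g
  id_comp f := O.one_comp₁ f
  comp_id f := O.comp₁_one f
  assoc f g h := O.comp₁_assoc f g h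

/-- The functor `j^* f` between the underlying categories. -/
def Hom.underlying {O : SymOperad C} {P : SymOperad D} (f : O.Hom P) :
    O.Underlying ⥤ P.Underlying where
  obj := f.onColour
  map o := f.onOp o
  map_id c := f.onOp_one c
  map_comp o o' := by
    exact (f.onOp_act _ _).trans (congrArg (P.act _) (f.onOp_comp _ _))

end SymOperad

/-! ### Morita equivalences -/

/-- Every object of the target is a retract of an object in the image. -/
def EssSurjUpToRetracts {A : Type*} {B : Type*} [Category A] [Category B] (F : A ⥤ B) :
    Prop :=
  ∀ y : B, ∃ x : A, Nonempty (Retract y (F.obj x))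

/-- A Morita equivalence of categories. -/
def IsMoritaFunctor {A : Type*} {B : Type*} [Category A] [Category B] (F : A ⥤ B) : Prop :=
  F.Full ∧ F.Faithful ∧ EssSurjUpToRetracts F

namespace SymOperad

variable {C D : Type u}

/-- `f` is bijective on all sets of operations. -/
def Hom.FullyFaithful {O : SymOperad C} {P : SymOperad D} (f : O.Hom P) : Prop :=
  ∀ (c : Word C) (d : C), Function.Bijective (f.onOp : O.Op c d → _)

/-- A Morita equivalence of symmetric coloured operads. -/
def Hom.IsMorita {O : SymOperad C} {P : SymOperad D} (f : O.Hom P) : Prop :=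
  f.FullyFaithful ∧ EssSurjUpToRetracts f.underlying

/-! ### Algebras -/

/-- An algebra in sets over the operad `O`. -/
structure Alg (O : SymOperad C) where
  carrier : C → Type u
  act : ∀ {c : Word C} {d : C}, O.Op c d → (∀ i, carrier (c.get i)) → carrier d
  act_one : ∀ {c : C} (x : carrier c), act (O.one c) (fun _ => x) = x
  act_comp : ∀ {c : Word C} {d : C} (o : O.Op c d) {b : Fin c.len → Word C}
    (q : ∀ i, O.Op (b i) (c.get i)) (x : ∀ i (j : Fin (b i).len), carrier ((b i).get j)),
    act (O.comp o q) (fun k => x (Word.split b k).1 (Word.split b k).2) =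
      act o fun i => act (q i) (x i)
  act_perm : ∀ {c : Word C} {d : C} {m : ℕ} (σ : Fin m ≃ Fin c.len) (o : O.Op (c.reindex σ) d)
    (x : ∀ i, carrier (c.get i)),
    act (O.act (Word.Perm.reindex c σ) o) x = act o fun i : Fin m => x (σ i)

/-- A morphism of algebras: a family of maps that commutes with all operations. -/
@[ext]
structure Alg.Hom {O : SymOperad C} (X Y : O.Alg) where
  app : ∀ c, X.carrier c → Y.carrier c
  app_act : ∀ {c : Word C} {d : C} (o : O.Op c d) (x : ∀ i, X.carrier (c.get i)),
    app d (X.act o x) = Y.act o fun i => app _ (x i)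

instance (O : SymOperad C) : Category.{u} O.Alg where
  Hom X Y := Alg.Hom X Y
  id X := ⟨fun _ x => x, fun _ _ => rfl⟩
  comp f g := ⟨fun c x => g.app c (f.app c x), fun o x => by rw [f.app_act, g.app_act]⟩

/-- The restriction functor `f^*` between the categories of algebras. -/
def Hom.pullback {O : SymOperad C} {P : SymOperad D} (f : O.Hom P) : P.Alg ⥤ O.Alg where
  obj X :=
    { carrier := fun c => X.carrier (f.onColour c)
      act := fun o x => X.act (f.onOp o) x
      act_one := fun x => by
        rw [f.onOp_one]
        exact X.act_one x
      act_comp := fun o b q x => by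
        rw [f.onOp_comp]
        exact X.act_comp (f.onOp o) (b := fun i => (b i).map f.onColour)
          (fun i => f.onOp (q i)) x
      act_perm := fun {c} {d} {m} σ o x => by
        rw [f.onOp_act]
        exact X.act_perm (c := c.map f.onColour) σ (f.onOp o) x }
  map h := ⟨fun c => h.app (f.onColour c), fun o x => h.app_act (f.onOp o) x⟩

end SymOperad

/-! ### Multi-sorted algebraic theories -/

/-- An `S`-sorted algebraic theory: a category with finite products whose objects are the
finite sequences in `S` and in which concatenation of sequences is the product. -/
structure AlgebraicTheory (S : Type u) where
  [cat : SmallCategory (Word S)]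
  [hasFiniteProducts : HasFiniteProducts (Word S)]
  nonempty_append_iso : ∀ a b : Word S, Nonempty (a.append b ≅ a ⨯ b)

namespace AlgebraicTheory

variable {S S' : Type u}

/-- The type of objects of the underlying category `u(T)`. -/
def Obj (_T : AlgebraicTheory S) : Type u := Word S

instance (T : AlgebraicTheory S) : SmallCategory T.Obj := T.cat

instance (T : AlgebraicTheory S) : HasFiniteProducts T.Obj := T.hasFiniteProducts

/-- A morphism of multi-sorted algebraic theories: a function on sorts and a finite product
preserving functor that extends it. -/
structure Hom (T : AlgebraicTheory S) (T' : AlgebraicTheory S') where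
  onSort : S → S'
  functor : T.Obj ⥤ T'.Obj
  preservesFiniteProducts : PreservesFiniteProducts functor
  obj_single : ∀ a : S, functor.obj (Word.single a : Word S) = (Word.single (onSort a) : Word S')

/-- A Morita equivalence of algebraic theories. -/
def Hom.IsMorita {T : AlgebraicTheory S} {T' : AlgebraicTheory S'} (f : T.Hom T') : Prop :=
  IsMoritaFunctor f.functor

end AlgebraicTheory

/-! ### The algebraic theory of an operad -/

namespace SymOperad

variable {C D : Type u}

/-- A representative of an element of the left Kan extension of `O(-; d)` along the inclusion
of the groupoid of finite sequences into the category of finite sequences: a sequence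
`c ∘ α` with its morphism `α` to `c`, and an operation `x` in `O(c ∘ α; d)`. -/
structure PreLan (O : SymOperad C) (c : Word C) (d : C) where
  arity : ℕ
  idx : Fin arity → Fin c.len
  op : O.Op (c.reindex idx) d

/-- Two representatives are identified if they differ by a permutation `σ`. -/
def PreLan.Rel {O : SymOperad C} {c : Word C} {d : C} (p q : O.PreLan c d) : Prop :=
  ∃ (σ : Fin p.arity ≃ Fin q.arity) (h : ∀ i, q.idx (σ i) = p.idx i),
    O.act (b := c.reindex p.idx) (c := c.reindex q.idx)
      ⟨σ, fun i => congrArg c.get (h i)⟩ p.op = q.op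

instance PreLan.setoid (O : SymOperad C) (c : Word C) (d : C) : Setoid (O.PreLan c d) where
  r := PreLan.Rel
  iseqv :=
    { refl := fun p => ⟨Equiv.refl _, fun _ => rfl, O.act_refl p.op⟩
      symm := by
        rintro p q ⟨σ, h, e⟩
        refine ⟨σ.symm, fun i => by rw [← h, σ.apply_symm_apply], ?_⟩
        rw [← e, ← O.act_trans]
        refine Eq.trans ?_ (O.act_refl p.op)
        congr 1
        apply Word.Perm.ext
        exact σ.self_trans_symm
      trans := by
        rintro p q r ⟨σ, h, e⟩ ⟨τ, k, e'⟩
        refine ⟨σ.trans τ, fun i => (k _).trans (h i), ?_⟩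
        rw [← e', ← e, ← O.act_trans]
        rfl }

/-- The set `(p_! O)(c; d)`, the value of the left Kan extension. -/
def Lan (O : SymOperad C) (c : Word C) (d : C) : Type u := Quotient (PreLan.setoid O c d)

namespace Lan

/-- The class of a representative. -/
def mk {O : SymOperad C} {c : Word C} {d : C} (m : ℕ) (α : Fin m → Fin c.len)
    (x : O.Op (c.reindex α) d) : O.Lan c d :=
  Quotient.mk _ ⟨m, α, x⟩

theorem ind {O : SymOperad C} {c : Word C} {d : C} (t : O.Lan c d) :
    ∃ (m : ℕ) (α : Fin m → Fin c.len) (x : O.Op (c.reindex α) d), t = mk m α x := by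
  obtain ⟨⟨m, α, x⟩, rfl⟩ := Quotient.exists_rep t
  exact ⟨m, α, x, rfl⟩

theorem sound {O : SymOperad C} {c : Word C} {d : C} {m m' : ℕ} {α : Fin m → Fin c.len}
    {α' : Fin m' → Fin c.len} {x : O.Op (c.reindex α) d} {x' : O.Op (c.reindex α') d}
    (σ : Fin m ≃ Fin m') (h : ∀ i, α' (σ i) = α i)
    (e : O.act (b := c.reindex α) (c := c.reindex α')
      ⟨σ, fun i => congrArg c.get (h i)⟩ x = x') :
    (mk m α x : O.Lan c d) = mk m' α' x' :=
  Quotient.sound ⟨σ, h, e⟩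

/-- The projection of `c` to its `i`-th entry. -/
def proj (O : SymOperad C) (c : Word C) (i : Fin c.len) : O.Lan c (c.get i) :=
  mk 1 (fun _ => i) (O.one (c.get i))

/-- Substitution of representatives: `q` is composed with the operations of the `f k`,
and the maps to `c` are put side by side. -/
def substPre {O : SymOperad C} {c b : Word C} {e : C} (q : O.Op b e)
    (f : ∀ k, O.PreLan c (b.get k)) : O.Lan c e :=
  mk (Word.join fun k => c.reindex (f k).idx).len
    (fun x => (f (Word.split (fun k => c.reindex (f k).idx) x).1).idx
      (Word.split (fun k => c.reindex (f k).idx) x).2)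
    (O.comp q fun k => (f k).op)

theorem substPre_congr {O : SymOperad C} {c b : Word C} {e : C} (q : O.Op b e)
    (f f' : ∀ k, O.PreLan c (b.get k)) (h : ∀ k, PreLan.Rel (f k) (f' k)) :
    substPre q f = substPre q f' := by
  choose σ hσ eσ using h
  have h1 := O.comp_act q
    (fun k => (⟨σ k, fun i => congrArg c.get (hσ k i)⟩ :
      Word.Perm (c.reindex (f k).idx) (c.reindex (f' k).idx))) (fun k => (f k).op)
  simp only [eσ] at h1
  refine sound (Word.Perm.joinCongr (fun k => (⟨σ k, fun i => congrArg c.get (hσ k i)⟩ :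
      Word.Perm (c.reindex (f k).idx) (c.reindex (f' k).idx)))).equiv (fun x => ?_) h1.symm
  refine (congrArg (fun p : (Σ k, Fin (f' k).arity) => (f' p.1).idx p.2)
    (Equiv.apply_symm_apply (Word.split fun k => c.reindex (f' k).idx) _)).trans ?_
  exact hσ _ _

/-- Substitution in `p_! O`. -/
noncomputable def subst {O : SymOperad C} {c d : Word C} {e : C} (t : O.Lan d e)
    (f : ∀ k, O.Lan c (d.get k)) : O.Lan c e :=
  Quotient.liftOn t
    (fun p => substPre p.op fun k => (f (p.idx k)).out)
    (by
      rintro ⟨m, α, x⟩ ⟨m', α', x'⟩ ⟨σ, h, e⟩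
      change Fin m ≃ Fin m' at σ
      change ∀ i, α' (σ i) = α i at h
      change O.act (b := d.reindex α) (c := d.reindex α')
        ⟨σ, fun i => congrArg d.get (h i)⟩ x = x' at e
      subst e
      obtain rfl : α = fun i => α' (σ i) := funext fun i => (h i).symm
      refine sound (Word.Perm.joinReindex σ
        (fun k => c.reindex (f (α' k)).out.idx)).equiv (fun y => ?_)
        (O.act_comp (c := d.reindex α') σ x
          (b := fun k => c.reindex (f (α' k)).out.idx) (fun k => (f (α' k)).out.op)).symm
      exact congrArg (fun p : (Σ k, Fin (f (α' k)).out.arity) => (f (α' p.1)).out.idx p.2)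
        (Equiv.apply_symm_apply (Word.split fun k => c.reindex (f (α' k)).out.idx) _))

/-- Substitution may be computed on arbitrary representatives. -/
theorem subst_mk {O : SymOperad C} {c d : Word C} {e : C} {m : ℕ} {β : Fin m → Fin d.len}
    (q : O.Op (d.reindex β) e) (f : ∀ k, O.Lan c (d.get k))
    (n : Fin m → ℕ) (α : ∀ k, Fin (n k) → Fin c.len)
    (x : ∀ k, O.Op (c.reindex (α k)) (d.get (β k)))
    (hf : ∀ k, f (β k) = mk (n k) (α k) (x k)) :
    subst (mk m β q) f =
      mk (Word.join fun k => c.reindex (α k)).len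
        (fun y => α (Word.split (fun k => c.reindex (α k)) y).1
          (Word.split (fun k => c.reindex (α k)) y).2)
        (O.comp q x) :=
  substPre_congr q (fun k => (f (β k)).out) (fun k => ⟨n k, α k, x k⟩) fun k =>
    Quotient.exact ((Quotient.out_eq _).trans (hf k))

theorem proj_subst {O : SymOperad C} {c d : Word C} (i : Fin d.len)
    (f : ∀ k, O.Lan c (d.get k)) : subst (proj O d i) f = f i := by
  obtain ⟨n, α, x, h⟩ := ind (f i)
  refine (subst_mk (β := fun _ : Fin 1 => i) (O.one (d.get i)) f (fun _ => n) (fun _ => α)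
    (fun _ => x) (fun _ => h)).trans (Eq.trans ?_ h.symm)
  exact sound (Word.Perm.joinSingle (c.reindex α)).equiv (fun _ => rfl) (O.one_comp x)

theorem subst_proj {O : SymOperad C} {c : Word C} {e : C} (t : O.Lan c e) :
    subst t (proj O c) = t := by
  obtain ⟨m, β, q, rfl⟩ := ind t
  refine (subst_mk q (proj O c) (fun _ => 1) (fun k _ => β k) (fun k => O.one (c.get (β k)))
    (fun _ => rfl)).trans ?_
  exact sound (Word.Perm.joinSingles (c.reindex β)).equiv (fun _ => rfl) (O.comp_one q)

theorem subst_subst {O : SymOperad C} {a c d : Word C} {e : C} (t : O.Lan d e)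
    (f : ∀ k, O.Lan c (d.get k)) (g : ∀ k, O.Lan a (c.get k)) :
    subst (subst t f) g = subst t fun k => subst (f k) g := by
  obtain ⟨m, β, q, rfl⟩ := ind t
  choose n α x hf using fun k => ind (f (β k))
  choose l γ y hg using fun k => ind (g k)
  rw [subst_mk q f n α x hf]
  refine (subst_mk (O.comp q x) g
    (fun z => l (α (Word.split (fun k => c.reindex (α k)) z).1
      (Word.split (fun k => c.reindex (α k)) z).2)) (fun z => γ _) (fun z => y _)
    (fun z => hg _)).trans ?_
  refine Eq.trans ?_ (subst_mk q (fun k => subst (f k) g) _ _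
    (fun k => O.comp (x k) fun j => y (α k j)) (fun k => by
      rw [hf]
      exact subst_mk (x k) g (fun j => l (α k j)) (fun j => γ (α k j)) (fun j => y (α k j))
        (fun j => hg _))).symm
  refine sound (Word.Perm.joinAssoc (fun k => c.reindex (α k))
    (fun k j => a.reindex (γ (α k j)))).equiv (fun z => ?_)
    (O.comp_assoc q x (a := fun k j => a.reindex (γ (α k j))) (fun k j => y (α k j)))
  refine (congrArg (fun p : (Σ k, Fin (Word.join fun j => a.reindex (γ (α k j))).len) =>
      γ (α p.1 (Word.split (fun j => a.reindex (γ (α p.1 j))) p.2).1)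
        (Word.split (fun j => a.reindex (γ (α p.1 j))) p.2).2)
    (Equiv.apply_symm_apply
      (Word.split fun k => Word.join fun j => a.reindex (γ (α k j))) _)).trans ?_
  exact congrArg (fun p : (Σ j, Fin (l (α _ j))) => γ (α _ p.1) p.2)
    (Equiv.apply_symm_apply (Word.split fun j => a.reindex (γ (α _ j))) _)

/-- The function between the left Kan extensions that is induced by a morphism of operads. -/
def map {O : SymOperad C} {P : SymOperad D} (f : O.Hom P) {c : Word C} {d : C} :
    O.Lan c d → P.Lan (c.map f.onColour) (f.onColour d) :=
  Quotient.lift (fun p => mk (c := c.map f.onColour) p.arity p.idx (f.onOp p.op)) (by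
    rintro ⟨m, α, x⟩ ⟨m', α', x'⟩ ⟨σ, h, e⟩
    change Fin m ≃ Fin m' at σ
    change ∀ i, α' (σ i) = α i at h
    change O.act (b := c.reindex α) (c := c.reindex α')
      ⟨σ, fun i => congrArg c.get (h i)⟩ x = x' at e
    subst e
    exact sound (c := c.map f.onColour) σ h
      (f.onOp_act (b := c.reindex _) (c := c.reindex α') ⟨σ, fun i => congrArg c.get (h i)⟩
        x).symm)

theorem map_proj {O : SymOperad C} {P : SymOperad D} (f : O.Hom P) (c : Word C)
    (i : Fin c.len) : map f (proj O c i) = proj P (c.map f.onColour) i :=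
  congrArg (mk (c := c.map f.onColour) 1 (fun _ => i)) (f.onOp_one _)

theorem map_subst {O : SymOperad C} {P : SymOperad D} (f : O.Hom P) {c d : Word C} {e : C}
    (t : O.Lan d e) (g : ∀ k, O.Lan c (d.get k)) :
    map f (subst t g) = subst (d := d.map f.onColour) (map f t) (fun k => map f (g k)) := by
  obtain ⟨m, β, q, rfl⟩ := ind t
  choose n α x hg using fun k => ind (g (β k))
  rw [subst_mk q g n α x hg]
  refine Eq.trans ?_ (subst_mk (c := c.map f.onColour) (d := d.map f.onColour) (β := β)
    (f.onOp (c := d.reindex β) q) (fun k => map f (g k)) n α (fun k => f.onOp (x k))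
    (fun k => congrArg (map f) (hg k))).symm
  exact congrArg (mk (c := c.map f.onColour) _ _) (f.onOp_comp q x)

end Lan

/-- The type of objects of the category that underlies the theory of `O`. -/
def TheoryObj (_O : SymOperad C) : Type u := Word C

/-- A finite sequence of colours, as an object of the theory of `O`. -/
def ofWord (O : SymOperad C) (c : Word C) : O.TheoryObj := c

/-- The morphisms from `c` to `d` are the elements of the product of the sets
`(p_! O)(c; dᵢ)`; composition is substitution. -/
noncomputable instance (O : SymOperad C) : SmallCategory O.TheoryObj where
  Hom c d := ∀ i : Fin (Word.len d), O.Lan c (Word.get d i)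
  id c := Lan.proj O c
  comp f g := fun j => Lan.subst (g j) f
  id_comp f := funext fun j => Lan.subst_proj (f j)
  comp_id f := funext fun j => Lan.proj_subst j f
  assoc f g h := funext fun j => (Lan.subst_subst (h j) g f).symm

/-- A product diagram in the theory of `O`: if the positions of `w` are the disjoint union
of those of `a` and `b`, compatibly with colours, then `w` is the product of `a` and `b`. -/
structure Decomp (w a b : Word C) where
  equiv : Fin a.len ⊕ Fin b.len ≃ Fin w.len
  left : ∀ i, w.get (equiv (.inl i)) = a.get i
  right : ∀ i, w.get (equiv (.inr i)) = b.get i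

/-- The decomposition of a concatenation. -/
def Decomp.append (a b : Word C) : Decomp (a.append b) a b where
  equiv := finSumFinEquiv
  left i := Fin.append_left a.get b.get i
  right i := Fin.append_right a.get b.get i

/-- The image of a decomposition under a function on colours. -/
def Decomp.map (φ : C → D) {w a b : Word C} (e : Decomp w a b) :
    Decomp (w.map φ) (a.map φ) (b.map φ) where
  equiv := e.equiv
  left i := congrArg φ (e.left i)
  right i := congrArg φ (e.right i)

/-- Transport of `p_! O` along an equality of output colours. -/
def Lan.cast {O : SymOperad C} {c : Word C} {d d' : C} (h : d = d') (t : O.Lan c d) :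
    O.Lan c d' := h ▸ t

theorem Lan.cast_subst {O : SymOperad C} {b c : Word C} {d d' : C} (h : d = d') (t : O.Lan c d)
    (f : ∀ k, O.Lan b (c.get k)) : Lan.subst (t.cast h) f = (Lan.subst t f).cast h := by
  subst h
  rfl

theorem Lan.map_cast {O : SymOperad C} {P : SymOperad D} (f : O.Hom P) {c : Word C} {d d' : C}
    (h : d = d') (t : O.Lan c d) :
    Lan.map f (t.cast h) = (Lan.map f t).cast (congrArg f.onColour h) := by
  subst h
  rfl

theorem Lan.cast_cast {O : SymOperad C} {c : Word C} {d d' d'' : C} (h : d = d') (h' : d' = d'')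
    (t : O.Lan c d) : (t.cast h).cast h' = t.cast (h.trans h') := by
  subst h h'
  rfl

theorem Lan.cast_apply {O : SymOperad C} {x w : Word C} (f : ∀ i, O.Lan x (w.get i))
    {i j : Fin w.len} (h : i = j) : (f i).cast (congrArg w.get h) = f j := by
  subst h
  rfl

namespace Decomp

variable {O : SymOperad C} {P : SymOperad D} {w a b : Word C}

/-- The first projection. -/
def fst (O : SymOperad C) (e : Decomp w a b) : O.ofWord w ⟶ O.ofWord a :=
  fun i => (Lan.proj O w (e.equiv (.inl i))).cast (e.left i)

/-- The second projection. -/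
def snd (O : SymOperad C) (e : Decomp w a b) : O.ofWord w ⟶ O.ofWord b :=
  fun i => (Lan.proj O w (e.equiv (.inr i))).cast (e.right i)

theorem comp_fst (e : Decomp w a b) {x : O.TheoryObj} (f : x ⟶ O.ofWord w) (i) :
    (f ≫ e.fst O) i = (f (e.equiv (.inl i))).cast (e.left i) :=
  (Lan.cast_subst _ _ _).trans (congrArg _ (Lan.proj_subst _ _))

theorem comp_snd (e : Decomp w a b) {x : O.TheoryObj} (f : x ⟶ O.ofWord w) (i) :
    (f ≫ e.snd O) i = (f (e.equiv (.inr i))).cast (e.right i) :=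
  (Lan.cast_subst _ _ _).trans (congrArg _ (Lan.proj_subst _ _))

/-- The components of the pairing of two morphisms. -/
def pairAux (e : Decomp w a b) {x : O.TheoryObj} (f : x ⟶ O.ofWord a)
    (g : x ⟶ O.ofWord b) : ∀ s, O.Lan x (w.get (e.equiv s))
  | .inl i => (f i).cast (e.left i).symm
  | .inr i => (g i).cast (e.right i).symm

/-- The pairing of two morphisms. -/
def pair (e : Decomp w a b) {x : O.TheoryObj} (f : x ⟶ O.ofWord a)
    (g : x ⟶ O.ofWord b) : x ⟶ O.ofWord w :=
  fun k => (e.pairAux f g (e.equiv.symm k)).cast (congrArg w.get (e.equiv.apply_symm_apply k))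

theorem pair_apply (e : Decomp w a b) {x : O.TheoryObj} (f : x ⟶ O.ofWord a)
    (g : x ⟶ O.ofWord b) (s) : e.pair f g (e.equiv s) = e.pairAux f g s := by
  have key : ∀ t (h : t = s), (e.pairAux f g t).cast
      (congrArg (fun t => w.get (e.equiv t)) h) = e.pairAux f g s := by
    rintro t rfl
    rfl
  exact key _ (e.equiv.symm_apply_apply s)

theorem pair_fst (e : Decomp w a b) {x : O.TheoryObj} (f : x ⟶ O.ofWord a)
    (g : x ⟶ O.ofWord b) : e.pair f g ≫ e.fst O = f := by
  funext i
  rw [comp_fst, pair_apply]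
  exact Lan.cast_cast _ _ _

theorem pair_snd (e : Decomp w a b) {x : O.TheoryObj} (f : x ⟶ O.ofWord a)
    (g : x ⟶ O.ofWord b) : e.pair f g ≫ e.snd O = g := by
  funext i
  rw [comp_snd, pair_apply]
  exact Lan.cast_cast _ _ _

theorem hom_ext (e : Decomp w a b) {x : O.TheoryObj} (f g : x ⟶ O.ofWord w)
    (h₁ : f ≫ e.fst O = g ≫ e.fst O) (h₂ : f ≫ e.snd O = g ≫ e.snd O) : f = g := by
  funext k
  obtain ⟨s, rfl⟩ := e.equiv.surjective k
  have inj : ∀ {d d' : C} (h : d = d') (t t' : O.Lan x d), t.cast h = t'.cast h → t = t' := by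
    rintro d _ rfl t t' h
    exact h
  rcases s with i | i
  · exact inj _ _ _ (((e.comp_fst f i).symm.trans (congrFun h₁ i)).trans (e.comp_fst g i))
  · exact inj _ _ _ (((e.comp_snd f i).symm.trans (congrFun h₂ i)).trans (e.comp_snd g i))

/-- The product diagram is a limit. -/
noncomputable def isLimit (O : SymOperad C) (e : Decomp w a b) :
    IsLimit (BinaryFan.mk (e.fst O) (e.snd O)) :=
  BinaryFan.isLimitMk (fun s => e.pair s.fst s.snd) (fun s => e.pair_fst s.fst s.snd)
    (fun s => e.pair_snd s.fst s.snd)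
    (fun s _ h₁ h₂ => e.hom_ext _ _ (h₁.trans (e.pair_fst s.fst s.snd).symm)
      (h₂.trans (e.pair_snd s.fst s.snd).symm))

end Decomp

/-- A sequence of length zero is terminal in the theory of `O`. -/
noncomputable def isTerminalOfLen (O : SymOperad C) (w : Word C) (h : w.len = 0) :
    IsTerminal (O.ofWord w) :=
  haveI : IsEmpty (Fin w.len) := h ▸ inferInstanceAs (IsEmpty (Fin 0))
  IsTerminal.ofUniqueHom (fun _ (i : Fin w.len) => isEmptyElim i)
    (fun _ _ => funext fun i : Fin w.len => isEmptyElim i)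

instance (O : SymOperad C) : HasFiniteProducts O.TheoryObj := by
  have : HasTerminal O.TheoryObj := (O.isTerminalOfLen Word.empty rfl).hasTerminal
  have : HasBinaryProducts O.TheoryObj := by
    have : ∀ a b : O.TheoryObj, HasLimit (Limits.pair a b) := fun a b =>
      ⟨⟨_, (Decomp.append (C := C) a b).isLimit O⟩⟩
    exact hasBinaryProducts_of_hasLimit_pair _
  exact hasFiniteProducts_of_has_binary_and_terminal

/-- The algebraic theory `𝕋(O)` of a symmetric coloured operad `O`. -/
noncomputable def theory (O : SymOperad C) : AlgebraicTheory C where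
  cat := inferInstanceAs (SmallCategory O.TheoryObj)
  hasFiniteProducts := inferInstanceAs (HasFiniteProducts O.TheoryObj)
  nonempty_append_iso a b :=
    ⟨((Decomp.append a b).isLimit O).conePointUniqueUpToIso
      (limit.isLimit (Limits.pair (O.ofWord a) (O.ofWord b)))⟩

/-- The functor that underlies the morphism of theories that is induced by `f`. -/
noncomputable def Hom.theoryFunctor {O : SymOperad C} {P : SymOperad D} (f : O.Hom P) :
    O.TheoryObj ⥤ P.TheoryObj where
  obj c := Word.map f.onColour c
  map h := fun i => Lan.map f (h i)
  map_id c := funext fun i => Lan.map_proj f c i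
  map_comp g h := funext fun j => Lan.map_subst f (h j) g

theorem Hom.theoryFunctor_fst {O : SymOperad C} {P : SymOperad D} (f : O.Hom P) {w a b : Word C}
    (e : Decomp w a b) :
    f.theoryFunctor.map (e.fst O) = (e.map f.onColour).fst P :=
  funext fun _ => (Lan.map_cast f _ _).trans (congrArg _ (Lan.map_proj f w _))

theorem Hom.theoryFunctor_snd {O : SymOperad C} {P : SymOperad D} (f : O.Hom P) {w a b : Word C}
    (e : Decomp w a b) :
    f.theoryFunctor.map (e.snd O) = (e.map f.onColour).snd P :=
  funext fun _ => (Lan.map_cast f _ _).trans (congrArg _ (Lan.map_proj f w _))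

/-- The image of a product diagram is a limit. -/
noncomputable def Hom.theoryFunctorIsLimit {O : SymOperad C} {P : SymOperad D} (f : O.Hom P)
    {w a b : Word C} (e : Decomp w a b) :
    IsLimit (BinaryFan.mk (f.theoryFunctor.map (e.fst O)) (f.theoryFunctor.map (e.snd O))) := by
  rw [f.theoryFunctor_fst, f.theoryFunctor_snd]
  exact (e.map f.onColour).isLimit P

theorem Hom.theoryFunctor_preserves {O : SymOperad C} {P : SymOperad D} (f : O.Hom P) :
    PreservesFiniteProducts f.theoryFunctor := by
  have : PreservesLimit (Functor.empty.{0} O.TheoryObj) f.theoryFunctor :=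
    preservesLimit_of_preserves_limit_cone (O.isTerminalOfLen Word.empty rfl)
      ((isLimitMapConeEmptyConeEquiv _ _).symm
        (P.isTerminalOfLen (Word.empty.map f.onColour) rfl))
  have : PreservesLimitsOfShape (Discrete.{0} PEmpty) f.theoryFunctor :=
    preservesLimitsOfShape_pempty_of_preservesTerminal _
  have : PreservesLimitsOfShape (Discrete WalkingPair) f.theoryFunctor := by
    refine ⟨fun {K} => ?_⟩
    have key : ∀ a b : O.TheoryObj, PreservesLimit (Limits.pair a b) f.theoryFunctor := by
      intro a b
      refine preservesLimit_of_preserves_limit_cone ((Decomp.append (C := C) a b).isLimit O)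
        ((isLimitMapConeBinaryFanEquiv _ _ _).symm (f.theoryFunctorIsLimit _))
    have := key (K.obj ⟨WalkingPair.left⟩) (K.obj ⟨WalkingPair.right⟩)
    exact preservesLimit_of_iso_diagram f.theoryFunctor (diagramIsoPair K).symm
  exact .of_preserves_binary_and_terminal _

/-- The morphism of algebraic theories `𝕋(f)`. -/
noncomputable def Hom.theoryHom {O : SymOperad C} {P : SymOperad D} (f : O.Hom P) :
    O.theory.Hom P.theory where
  onSort := f.onColour
  functor := f.theoryFunctor
  preservesFiniteProducts := f.theoryFunctor_preserves
  obj_single _ := rfl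

end SymOperad
end ColouredOperad

/-!
The proof passes through the sets `(p_! O)(w; d)` of operations whose variables may be repeated
or left out. An algebra over `O` is the same as a model of its theory: a family of sets on which
`p_! O` acts compatibly with projections and substitution (`Alg.eval`, `Alg.ofEval`). In this
form no permutations or concatenations appear, and `w ↦ (p_! O)(w; -)` is the free algebra on
generators of the colours in `w` (`Alg.free`).

*Left adjoint.* `f_! X` is the set of formal expressions in operations of `P` and elements of `X`,
modulo the least congruence that makes it a `P`-algebra receiving a morphism from `X`
(`Hom.extend`).

*Operads and theories.* An element of `(p_! O)(w; d)` is an operation with a renaming of its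
variables, up to permutation. Hence `f` is bijective on operations if and only if it is bijective
on `p_!`. A colour that is a retract of a sequence of colours in the theory is already a retract
of one entry by unary operations: the arities in a composite that equals the identity add up to
one, so that exactly one variable of the retraction is used, and it receives nullary operations in
all others (`Lan.exists_retract`).

*From operads to algebras.* Choose for every colour `d` of `P` a colour `c` of `O` such that `d` is
a retract of `f(c)`. Conjugation with these retracts, followed by the inverse of `f`, turns
operations of `P` into operations of `O`, and respects substitution (`Retraction.conj_subst`). It
is used to extend a morphism of restricted algebras to all colours, and to extend an `O`-algebra
`X` to a `P`-algebra whose value at `d` is the set of fixed points in `X_c` of the idempotent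
that belongs to `d`. Hence `f^*` is full, faithful and essentially surjective.

*From algebras to operads.* The left adjoint sends the free algebra on `w` to the free algebra on
`f(w)`, and the unit becomes the function between the sets `(p_! O)(w; d)` and
`(p_! P)(f(w); f(d))`, which is therefore bijective (`Hom.lanBijective_of_isIso_unit`). The
subalgebra of a `P`-algebra `Y` that is generated by the colours in the image of `f` has the same
restriction as `Y`; so it is all of `Y` if `f^*` reflects isomorphisms. For the free algebra on a
single colour `d`, this presents the generator as a value of an operation on elements whose
colours are in the image, that is, it shows `d` to be a retract of a sequence in the image of `f`.
-/

namespace ColouredOperad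

namespace SymOperad

variable {C D : Type u} {O : SymOperad C} {P : SymOperad D}

/-! ### Algebras as models of the theory -/

/-- An operation `o ∈ O(w; d)`, viewed as an element of `(p_! O)(w; d)`. -/
def Lan.ofOp {w : Word C} {d : C} (o : O.Op w d) : O.Lan w d :=
  mk w.len (fun i => i) o

theorem Lan.ofOp_one (c : C) : (Lan.ofOp (O.one c)) = Lan.proj O (Word.single c) (0 : Fin 1) :=
  congrArg (fun α : Fin 1 → Fin 1 => (Lan.mk (c := Word.single c) 1 α (O.one c)))
    (funext fun i : Fin 1 => Subsingleton.elim (α := Fin 1) i 0)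

theorem Lan.ofOp_subst {a w : Word C} {d : C} (o : O.Op w d) {n : Fin w.len → ℕ}
    (α : ∀ k, Fin (n k) → Fin a.len) (x : ∀ k, O.Op (a.reindex (α k)) (w.get k)) :
    Lan.subst (Lan.ofOp o) (fun k => Lan.mk (n k) (α k) (x k)) =
      Lan.mk (Word.join fun k => a.reindex (α k)).len
        (fun y => α (Word.split (fun k => a.reindex (α k)) y).1
          (Word.split (fun k => a.reindex (α k)) y).2)
        (O.comp o x) :=
  Lan.subst_mk (β := fun i => i) o _ n α x (fun _ => rfl)

/-- Every element of `p_! O` is an operation with its variables renamed. -/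
theorem Lan.ofOp_subst_proj {w : Word C} {d : C} {m : ℕ} (α : Fin m → Fin w.len)
    (o : O.Op (w.reindex α) d) :
    Lan.subst (Lan.ofOp o) (fun i => Lan.proj O w (α i)) = Lan.mk m α o := by
  refine (Lan.ofOp_subst o (n := fun _ => 1) (fun k _ => α k)
    (fun k => O.one (w.get (α k)))).trans ?_
  exact Lan.sound (Word.Perm.joinSingles (w.reindex α)).equiv (fun _ => rfl) (O.comp_one o)

theorem Lan.ofOp_act {b w : Word C} {d : C} (τ : Word.Perm b w) (o : O.Op b d) :
    (Lan.ofOp (O.act τ o)) =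
      Lan.subst (Lan.ofOp o) (fun j => (Lan.proj O w (τ.equiv j)).cast (τ.comm j)) := by
  obtain ⟨n, g⟩ := b
  obtain ⟨σ, h⟩ := τ
  change Fin n ≃ Fin w.len at σ
  change ∀ i : Fin n, w.get (σ i) = g i at h
  obtain rfl : (fun i => w.get (σ i)) = g := funext h
  refine Eq.trans ?_ (Lan.ofOp_subst_proj (fun i => σ i) o).symm
  exact (Lan.sound (c := w) σ (fun i => rfl) rfl).symm

/-- The inclusion of the variables of the `i`-th block into the variables of a concatenation. -/
noncomputable def Lan.block (O : SymOperad C) {n : ℕ} (b : Fin n → Word C) (i : Fin n) :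
    ∀ j, O.Lan (Word.join b) ((b i).get j) :=
  fun j => (Lan.proj O (Word.join b) ((Word.split b).symm ⟨i, j⟩)).cast
    (Word.get_split_symm b ⟨i, j⟩)

/-- An evaluation that sends the variables of a concatenation to given values sends the variables
of a block to the values in that block. -/
theorem Lan.apply_block {A : C → Type u} {n : ℕ} {b : Fin n → Word C}
    (φ : ∀ {d : C}, O.Lan (Word.join b) d → A d) (x : ∀ i (j : Fin (b i).len), A ((b i).get j))
    (hφ : ∀ k, φ (Lan.proj O (Word.join b) k) = x (Word.split b k).1 (Word.split b k).2)
    (i : Fin n) (j : Fin (b i).len) : φ (Lan.block O b i j) = x i j := by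
  have cast_apply : ∀ {d d' : C} (h : d = d') (t : O.Lan (Word.join b) d),
      φ (t.cast h) = h ▸ φ t := by
    rintro d _ rfl t
    rfl
  have cast_value : ∀ (p q : Σ i, Fin (b i).len) (_ : p = q)
      (e : (b p.1).get p.2 = (b q.1).get q.2), (e ▸ x p.1 p.2 : A _) = x q.1 q.2 := by
    rintro p _ rfl e
    rfl
  refine (cast_apply _ _).trans ?_
  refine (congrArg (fun z => (Word.get_split_symm b ⟨i, j⟩ ▸ z : A _)) (hφ _)).trans ?_
  exact cast_value _ ⟨i, j⟩ ((Word.split b).apply_symm_apply _) _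

/-- Composition in the operad is substitution into disjoint blocks of variables. -/
theorem Lan.ofOp_comp {c : Word C} {d : C} (o : O.Op c d) {b : Fin c.len → Word C}
    (q : ∀ i, O.Op (b i) (c.get i)) :
    Lan.ofOp (O.comp o q) =
      Lan.subst (Lan.ofOp o) (fun i => Lan.subst (Lan.ofOp (q i)) (Lan.block O b i)) := by
  let τ : ∀ i, Word.Perm (b i)
      ((Word.join b).reindex fun j : Fin (b i).len => (Word.split b).symm ⟨i, j⟩) := fun i =>
    ⟨Equiv.refl _, fun j => Word.get_split_symm b ⟨i, j⟩⟩
  have key : ∀ i, Lan.subst (Lan.ofOp (q i)) (Lan.block O b i) =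
      Lan.mk (c := Word.join b) (b i).len (fun j => (Word.split b).symm ⟨i, j⟩)
        (O.act (τ i) (q i)) := by
    intro i
    refine Eq.trans ?_ (Lan.ofOp_subst_proj _ _)
    rw [Lan.ofOp_act]
    refine Eq.trans ?_ (Lan.subst_subst _ _ _).symm
    refine congrArg (Lan.subst _) (funext fun j => ?_)
    refine Eq.trans ?_ (Lan.cast_subst _ _ _).symm
    exact congrArg (fun t => Lan.cast _ t) (Lan.proj_subst _ _).symm
  refine Eq.trans ?_ (congrArg (Lan.subst (Lan.ofOp o)) (funext key)).symm
  refine Eq.trans ?_ (Lan.ofOp_subst o _ _).symm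
  refine Lan.sound (Word.Perm.joinCongr τ).equiv (fun y => ?_) (O.comp_act o τ q).symm
  refine (congrArg (fun p : (Σ i, Fin (b i).len) => (Word.split b).symm ⟨p.1, p.2⟩)
    (Equiv.apply_symm_apply (Word.split fun i => (Word.join b).reindex
      fun j : Fin (b i).len => (Word.split b).symm ⟨i, j⟩) _)).trans ?_
  exact (Word.split b).symm_apply_apply y

namespace Alg

/-- The action of `p_! O` on an algebra over `O`: variables may be repeated or left out.
This exhibits an algebra over an operad as a model of the theory of the operad. -/
def eval (X : O.Alg) {w : Word C} {d : C} (t : O.Lan w d)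
    (x : ∀ i, X.carrier (w.get i)) : X.carrier d :=
  Quotient.liftOn t (fun p => X.act p.op fun i => x (p.idx i)) (by
    rintro ⟨m, α, o⟩ ⟨m', α', o'⟩ ⟨σ, h, e⟩
    change Fin m ≃ Fin m' at σ
    change ∀ i, α' (σ i) = α i at h
    change O.act (b := w.reindex α) (c := w.reindex α')
      ⟨σ, fun i => congrArg w.get (h i)⟩ o = o' at e
    subst e
    obtain rfl : α = fun i => α' (σ i) := funext fun i => (h i).symm
    exact (X.act_perm (c := w.reindex α') σ o (fun i => x (α' i))).symm)

theorem eval_proj (X : O.Alg) (w : Word C) (i : Fin w.len) (x : ∀ i, X.carrier (w.get i)) :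
    X.eval (Lan.proj O w i) x = x i :=
  X.act_one (x i)

theorem eval_subst (X : O.Alg) {w v : Word C} {d : C} (t : O.Lan w d)
    (g : ∀ k, O.Lan v (w.get k)) (x : ∀ i, X.carrier (v.get i)) :
    X.eval (Lan.subst t g) x = X.eval t fun k => X.eval (g k) x := by
  obtain ⟨m, β, q, rfl⟩ := Lan.ind t
  choose n α y hg using fun k => Lan.ind (g k)
  obtain rfl : g = fun k => Lan.mk (n k) (α k) (y k) := funext hg
  rw [Lan.subst_mk q _ (fun k => n (β k)) (fun k => α (β k)) (fun k => y (β k))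
    (fun _ => rfl)]
  exact X.act_comp q (fun k => y (β k)) (fun i j => x (α (β i) j))

theorem eval_ofOp (X : O.Alg) {w : Word C} {d : C} (o : O.Op w d)
    (x : ∀ i, X.carrier (w.get i)) : X.eval (Lan.ofOp o) x = X.act o x :=
  rfl

theorem eval_pullback (f : O.Hom P) (X : P.Alg) {w : Word C} {d : C} (t : O.Lan w d)
    (x : ∀ i, X.carrier ((w.map f.onColour).get i)) :
    (f.pullback.obj X).eval t x = X.eval (Lan.map f t) x := by
  obtain ⟨m, β, q, rfl⟩ := Lan.ind t
  rfl

theorem Hom.app_eval {X Y : O.Alg} (h : Alg.Hom X Y) {w : Word C} {d : C} (t : O.Lan w d)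
    (x : ∀ i, X.carrier (w.get i)) :
    h.app d (X.eval t x) = Y.eval t fun i => h.app _ (x i) := by
  obtain ⟨m, β, q, rfl⟩ := Lan.ind t
  exact h.app_act q _

theorem hom_ext {X Y : O.Alg} {g h : X ⟶ Y}
    (e : ∀ c x, Alg.Hom.app g c x = Alg.Hom.app h c x) : g = h :=
  Alg.Hom.ext (funext fun c => funext (e c))

/-- A model of the theory, given by an action of `p_! O` that is compatible with projections
and with substitution, is an algebra over `O`. -/
def ofEval (A : C → Type u) (ev : ∀ {w : Word C} {d : C}, O.Lan w d → (∀ i, A (w.get i)) → A d)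
    (ev_proj : ∀ (w : Word C) (i : Fin w.len) (x : ∀ i, A (w.get i)),
      ev (Lan.proj O w i) x = x i)
    (ev_subst : ∀ {w v : Word C} {d : C} (t : O.Lan w d) (g : ∀ k, O.Lan v (w.get k))
      (x : ∀ i, A (v.get i)), ev (Lan.subst t g) x = ev t fun k => ev (g k) x) : O.Alg where
  carrier := A
  act o x := ev (Lan.ofOp o) x
  act_one {c} x := by
    rw [Lan.ofOp_one]
    exact ev_proj (Word.single c) (0 : Fin 1) fun _ => x
  act_comp {c d} o b q x := by
    rw [Lan.ofOp_comp]
    refine (ev_subst _ _ _).trans (congrArg (ev _) (funext fun i => ?_))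
    refine (ev_subst _ _ _).trans (congrArg (ev _) (funext fun j => ?_))
    exact Lan.apply_block (fun t => ev t _) x (fun k => ev_proj _ k _) i j
  act_perm {c d m} σ o x := by
    have e : Lan.ofOp (O.act (Word.Perm.reindex c σ) o) =
        Lan.subst (Lan.ofOp o) fun i => Lan.proj O c (σ i) := Lan.ofOp_act _ _
    rw [e]
    exact (ev_subst _ _ _).trans
      (congrArg (ev (Lan.ofOp o)) (funext fun i => ev_proj c (σ i) x))

theorem eval_ofEval (A : C → Type u)
    (ev : ∀ {w : Word C} {d : C}, O.Lan w d → (∀ i, A (w.get i)) → A d)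
    (ev_proj : ∀ (w : Word C) (i : Fin w.len) (x : ∀ i, A (w.get i)),
      ev (Lan.proj O w i) x = x i)
    (ev_subst : ∀ {w v : Word C} {d : C} (t : O.Lan w d) (g : ∀ k, O.Lan v (w.get k))
      (x : ∀ i, A (v.get i)), ev (Lan.subst t g) x = ev t fun k => ev (g k) x)
    {w : Word C} {d : C} (t : O.Lan w d) (x : ∀ i, A (w.get i)) :
    (ofEval A ev ev_proj ev_subst).eval t x = ev t x := by
  obtain ⟨m, β, q, rfl⟩ := Lan.ind t
  refine Eq.trans ?_ (congrArg (fun s => ev s x) (Lan.ofOp_subst_proj β q))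
  refine Eq.trans ?_ (ev_subst _ _ _).symm
  exact congrArg (ev (Lan.ofOp q)) (funext fun i => (ev_proj w (β i) x).symm)

theorem eval_block (X : O.Alg) {n : ℕ} (b : Fin n → Word C)
    (x : ∀ i (j : Fin (b i).len), X.carrier ((b i).get j)) (i : Fin n) (j : Fin (b i).len) :
    X.eval (Lan.block O b i j) (fun k => x (Word.split b k).1 (Word.split b k).2) = x i j :=
  Lan.apply_block (fun t => X.eval t _) x (fun k => X.eval_proj _ k _) i j

/-- The free algebra on generators of the colours `w₁, …, wₙ`. -/
noncomputable def free (O : SymOperad C) (w : Word C) : O.Alg :=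
  ofEval (O.Lan w) (fun t g => Lan.subst t g) (fun _ i g => Lan.proj_subst i g)
    (fun t g x => Lan.subst_subst t g x)

theorem eval_free {w v : Word C} {d : C} (t : O.Lan v d) (g : ∀ k, O.Lan w (v.get k)) :
    (free O w).eval t g = Lan.subst t g :=
  eval_ofEval (O.Lan w) (fun t g => Lan.subst t g) (fun _ i g => Lan.proj_subst i g)
    (fun t g x => Lan.subst_subst t g x) t g

/-- The morphism out of a free algebra with prescribed values on the generators. -/
def freeDesc {w : Word C} (X : O.Alg) (x : ∀ i, X.carrier (w.get i)) : free O w ⟶ X where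
  app _ t := X.eval t x
  app_act o g := X.eval_subst (Lan.ofOp o) g x

theorem freeDesc_proj {w : Word C} (X : O.Alg) (x : ∀ i, X.carrier (w.get i)) (i : Fin w.len) :
    Alg.Hom.app (freeDesc X x) _ (Lan.proj O w i) = x i :=
  X.eval_proj w i x

/-- A morphism out of a free algebra is determined by its values on the generators. -/
theorem app_free {w : Word C} {X : O.Alg} (h : free O w ⟶ X) {d : C} (t : O.Lan w d) :
    Alg.Hom.app h d t = X.eval t fun i => Alg.Hom.app h _ (Lan.proj O w i) := by
  have e := Alg.Hom.app_eval h t (fun i => Lan.proj O w i)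
  rwa [eval_free, Lan.subst_proj] at e

theorem free_hom_ext {w : Word C} {X : O.Alg} {g h : free O w ⟶ X}
    (e : ∀ i, Alg.Hom.app g _ (Lan.proj O w i) = Alg.Hom.app h _ (Lan.proj O w i)) : g = h :=
  hom_ext fun _ t =>
    (app_free g t).trans ((congrArg (X.eval t) (funext e)).trans (app_free h t).symm)

/-- An isomorphism of algebras is bijective on every colour. -/
theorem bijective_of_isIso {X Y : O.Alg} (h : X ⟶ Y) [IsIso h] (c : C) :
    Function.Bijective (Alg.Hom.app h c) :=
  Function.bijective_iff_has_inverse.2 ⟨Alg.Hom.app (inv h) c,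
    fun x => congrFun (congrFun (congrArg Alg.Hom.app (IsIso.hom_inv_id h)) c) x,
    fun x => congrFun (congrFun (congrArg Alg.Hom.app (IsIso.inv_hom_id h)) c) x⟩

end Alg

/-! ### The left adjoint of restriction -/

/-- Formal expressions in the operations of `P` and the elements of the `O`-algebra `X`. -/
inductive Hom.Term (f : O.Hom P) (X : O.Alg) : D → Type u
  | var {c : C} (x : X.carrier c) : Hom.Term f X (f.onColour c)
  | op {w : Word D} {d : D} (p : P.Op w d) (a : ∀ i, Hom.Term f X (w.get i)) : Hom.Term f X d

/-- The least congruence on formal expressions for which they form a `P`-algebra and for which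
the inclusion of `X` is a morphism of `O`-algebras. -/
inductive Hom.TermRel (f : O.Hom P) (X : O.Alg) : ∀ {d : D}, f.Term X d → f.Term X d → Prop
  | refl {d : D} (a : f.Term X d) : Hom.TermRel f X a a
  | symm {d : D} {a b : f.Term X d} : Hom.TermRel f X a b → Hom.TermRel f X b a
  | trans {d : D} {a b c : f.Term X d} :
      Hom.TermRel f X a b → Hom.TermRel f X b c → Hom.TermRel f X a c
  | congr {w : Word D} {d : D} (p : P.Op w d) {a b : ∀ i, f.Term X (w.get i)} :
      (∀ i, Hom.TermRel f X (a i) (b i)) → Hom.TermRel f X (.op p a) (.op p b)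
  | one {d : D} (a : f.Term X d) : Hom.TermRel f X (.op (P.one d) fun _ => a) a
  | comp {c : Word D} {d : D} (p : P.Op c d) {b : Fin c.len → Word D}
      (q : ∀ i, P.Op (b i) (c.get i)) (a : ∀ i (j : Fin (b i).len), f.Term X ((b i).get j)) :
      Hom.TermRel f X
        (.op (P.comp p q) fun k => a (Word.split b k).1 (Word.split b k).2)
        (.op p fun i => .op (q i) (a i))
  | perm {c : Word D} {d : D} {m : ℕ} (σ : Fin m ≃ Fin c.len) (p : P.Op (c.reindex σ) d)
      (a : ∀ i, f.Term X (c.get i)) :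
      Hom.TermRel f X (.op (P.act (Word.Perm.reindex c σ) p) a)
        (.op p fun i : Fin m => a (σ i))
  | var {w : Word C} {d : C} (o : O.Op w d) (x : ∀ i, X.carrier (w.get i)) :
      Hom.TermRel f X (.var (X.act o x)) (.op (f.onOp o) fun i => .var (x i))

/-- Formal expressions up to congruence. -/
instance Hom.termSetoid (f : O.Hom P) (X : O.Alg) (d : D) : Setoid (f.Term X d) where
  r := Hom.TermRel f X
  iseqv := ⟨.refl, .symm, .trans⟩

theorem Hom.TermRel.sound {f : O.Hom P} {X : O.Alg} {d : D} {a b : f.Term X d}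
    (r : Hom.TermRel f X a b) :
    (Quotient.mk _ a : Quotient (f.termSetoid X d)) = Quotient.mk _ b :=
  Quotient.sound r

/-- The operations of `P` on formal expressions up to congruence. -/
noncomputable def Hom.termAct (f : O.Hom P) (X : O.Alg) {w : Word D} {d : D} (p : P.Op w d)
    (a : ∀ i, Quotient (f.termSetoid X (w.get i))) : Quotient (f.termSetoid X d) :=
  Quotient.mk _ (.op p fun i => (a i).out)

theorem Hom.termAct_mk (f : O.Hom P) (X : O.Alg) {w : Word D} {d : D} (p : P.Op w d)
    (a : ∀ i, f.Term X (w.get i)) :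
    f.termAct X p (fun i => Quotient.mk _ (a i)) = Quotient.mk _ (.op p a) :=
  Hom.TermRel.sound (.congr p fun i => Quotient.mk_out (a i))

/-- The `P`-algebra `f_! X`. -/
noncomputable def Hom.extend (f : O.Hom P) (X : O.Alg) : P.Alg where
  carrier d := Quotient (f.termSetoid X d)
  act p a := f.termAct X p a
  act_one x := by
    obtain ⟨a, rfl⟩ := Quotient.exists_rep x
    exact (f.termAct_mk X (P.one _) fun _ => a).trans (Hom.TermRel.one a).sound
  act_comp {c d} p b q x := by
    choose a ha using fun i j => Quotient.exists_rep (x i j)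
    obtain rfl : (fun i j => Quotient.mk _ (a i j)) = x := funext fun i => funext (ha i)
    refine (f.termAct_mk X (P.comp p q)
      (fun k => a (Word.split b k).1 (Word.split b k).2)).trans ?_
    refine (Hom.TermRel.sound (.comp p q a)).trans ?_
    refine (f.termAct_mk X p _).symm.trans ?_
    exact congrArg (f.termAct X p) (funext fun i => (f.termAct_mk X (q i) (a i)).symm)
  act_perm {c d m} σ p x := by
    choose a ha using fun i => Quotient.exists_rep (x i)
    obtain rfl : (fun i => Quotient.mk _ (a i)) = x := funext ha
    refine (f.termAct_mk X _ a).trans ((Hom.TermRel.sound (.perm σ p a)).trans ?_)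
    exact (f.termAct_mk X p fun i : Fin m => a (σ i)).symm

/-- The universal morphism `X ⟶ f^* f_! X`. -/
noncomputable def Hom.extendUnit (f : O.Hom P) (X : O.Alg) :
    X ⟶ f.pullback.obj (f.extend X) where
  app _ x := Quotient.mk _ (.var x)
  app_act o x := (Hom.TermRel.sound (.var o x)).trans
    (f.termAct_mk X (f.onOp o) fun i => .var (x i)).symm

/-- The value of a formal expression in a `P`-algebra. -/
def Hom.termValue (f : O.Hom P) {X : O.Alg} {Z : P.Alg} (h : X ⟶ f.pullback.obj Z) :
    ∀ {d : D}, f.Term X d → Z.carrier d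
  | _, .var x => Alg.Hom.app h _ x
  | _, .op p a => Z.act p fun i => f.termValue h (a i)

theorem Hom.termValue_congr (f : O.Hom P) {X : O.Alg} {Z : P.Alg} (h : X ⟶ f.pullback.obj Z)
    {d : D} {a b : f.Term X d} (r : Hom.TermRel f X a b) :
    f.termValue h a = f.termValue h b := by
  induction r with
  | refl a => rfl
  | symm _ ih => exact ih.symm
  | trans _ _ ih ih' => exact ih.trans ih'
  | congr p _ ih => exact congrArg (Z.act p) (funext ih)
  | one a => exact Z.act_one (f.termValue h a)
  | comp p q a => exact Z.act_comp p q fun i j => f.termValue h (a i j)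
  | perm σ p a => exact Z.act_perm σ p fun i => f.termValue h (a i)
  | var o x => exact Alg.Hom.app_act h o x

/-- The morphism `f_! X ⟶ Z` that extends a morphism `X ⟶ f^* Z`. -/
noncomputable def Hom.extendDesc (f : O.Hom P) {X : O.Alg} {Z : P.Alg}
    (h : X ⟶ f.pullback.obj Z) : f.extend X ⟶ Z where
  app _ := Quotient.lift (f.termValue h) fun _ _ r => f.termValue_congr h r
  app_act p x := by
    choose a ha using fun i => Quotient.exists_rep (x i)
    obtain rfl : (fun i => Quotient.mk _ (a i)) = x := funext ha
    exact congrArg (Quotient.lift (f.termValue h) fun _ _ r => f.termValue_congr h r)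
      (f.termAct_mk X p a)

theorem Hom.extend_hom_ext (f : O.Hom P) {X : O.Alg} {Z : P.Alg} {g h : f.extend X ⟶ Z}
    (e : f.extendUnit X ≫ f.pullback.map g = f.extendUnit X ≫ f.pullback.map h) : g = h := by
  refine Alg.hom_ext fun d x => ?_
  obtain ⟨a, rfl⟩ := Quotient.exists_rep x
  induction a with
  | var x => exact congrFun (congrFun (congrArg Alg.Hom.app e) _) x
  | op p a ih =>
    have act : ∀ k : f.extend X ⟶ Z, Alg.Hom.app k _ (Quotient.mk _ (.op p a)) =
        Z.act p fun i => Alg.Hom.app k _ (Quotient.mk _ (a i)) := fun k =>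
      (congrArg (Alg.Hom.app k _) (f.termAct_mk X p a)).symm.trans (Alg.Hom.app_act k p _)
    rw [act g, act h, funext ih]

theorem Hom.pullback_isRightAdjoint (f : O.Hom P) : f.pullback.IsRightAdjoint := by
  have : ∀ X : O.Alg, HasInitial (StructuredArrow X f.pullback) := fun X =>
    (IsInitial.ofUniqueHom (X := StructuredArrow.mk (f.extendUnit X))
      (fun Z => StructuredArrow.homMk (f.extendDesc Z.hom) rfl)
      (fun Z m => StructuredArrow.ext _ _ (f.extend_hom_ext
        ((StructuredArrow.w m).trans rfl)))).hasInitial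
  exact isRightAdjointOfStructuredArrowInitials f.pullback

/-! ### Bijectivity on operations and on the theory -/

theorem Lan.ofOp_injective {w : Word C} {d : C} :
    Function.Injective (Lan.ofOp : O.Op w d → O.Lan w d) := by
  intro o o' e
  obtain ⟨σ, h, e⟩ := Quotient.exact e
  change Fin w.len ≃ Fin w.len at σ
  change ∀ i : Fin w.len, σ i = i at h
  obtain rfl : σ = Equiv.refl _ := Equiv.ext h
  exact (O.act_refl o).symm.trans e

theorem Lan.map_ofOp (f : O.Hom P) {w : Word C} {d : C} (o : O.Op w d) :
    Lan.map f (Lan.ofOp o) = Lan.ofOp (f.onOp o) :=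
  rfl

/-- `f` is bijective on the hom-sets `(p_! O)(w; d)` into one-term sequences. -/
def Hom.LanBijective (f : O.Hom P) : Prop :=
  ∀ (w : Word C) (d : C), Function.Bijective (Lan.map f : O.Lan w d → _)

theorem Hom.FullyFaithful.lanBijective {f : O.Hom P} (hf : f.FullyFaithful) :
    f.LanBijective := by
  refine fun w d => ⟨fun t t' e => ?_, fun t => ?_⟩
  · obtain ⟨m, α, x, rfl⟩ := Lan.ind t
    obtain ⟨m', α', x', rfl⟩ := Lan.ind t'
    obtain ⟨σ, h, e⟩ := Quotient.exact e
    refine Lan.sound σ h ((hf _ _).1 ?_)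
    exact (f.onOp_act (b := w.reindex α) (c := w.reindex α') _ x).trans e
  · obtain ⟨m, α, y, rfl⟩ := Lan.ind t
    obtain ⟨x, rfl⟩ := (hf (w.reindex α) d).2 y
    exact ⟨Lan.mk m α x, rfl⟩

theorem Hom.LanBijective.fullyFaithful {f : O.Hom P} (hf : f.LanBijective) :
    f.FullyFaithful := by
  refine fun w d => ⟨fun x x' e => Lan.ofOp_injective ((hf w d).1 ?_), fun y => ?_⟩
  · rw [Lan.map_ofOp, Lan.map_ofOp, e]
  · obtain ⟨t, ht⟩ := (hf w d).2 (Lan.ofOp y)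
    obtain ⟨m, α, x, rfl⟩ := Lan.ind t
    -- The renaming `α` of the variables is bijective, because the arities agree.
    obtain ⟨σ, h, e⟩ := Quotient.exact ht
    change Fin m ≃ Fin w.len at σ
    obtain rfl : α = σ := funext fun i => (h i).symm
    exact ⟨O.act (Word.Perm.reindex w σ) x, (f.onOp_act _ x).trans e⟩

theorem Hom.LanBijective.full {f : O.Hom P} (hf : f.LanBijective) : f.theoryFunctor.Full where
  map_surjective {v w} g := by
    choose t ht using fun i : Fin (Word.len w) => (hf v (Word.get w i)).2 (g i)
    exact ⟨t, funext ht⟩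

theorem Hom.LanBijective.faithful {f : O.Hom P} (hf : f.LanBijective) :
    f.theoryFunctor.Faithful where
  map_injective {v w} _ _ e := funext fun i => (hf v (Word.get w i)).1 (congrFun e i)

theorem Hom.lanBijective_of_theoryFunctor (f : O.Hom P) (h₁ : f.theoryFunctor.Full)
    (h₂ : f.theoryFunctor.Faithful) : f.LanBijective := by
  refine fun w d => ⟨fun t t' e => ?_, fun t => ?_⟩
  · exact congrFun (f.theoryFunctor.map_injective (X := O.ofWord w)
      (Y := O.ofWord (Word.single d)) (a₁ := fun _ => t) (a₂ := fun _ => t')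
      (funext fun _ => e)) (0 : Fin 1)
  · obtain ⟨s, hs⟩ := f.theoryFunctor.map_surjective (X := O.ofWord w)
      (Y := O.ofWord (Word.single d)) (fun _ => t)
    exact ⟨s (0 : Fin 1), congrFun hs (0 : Fin 1)⟩

/-! ### Retracts in the theory of an operad -/

/-- Substitution into an element of `p_! O` with a single variable. -/
noncomputable def Lan.after {w : Word C} {a b : C} (t : O.Lan (Word.single a) b)
    (s : O.Lan w a) : O.Lan w b :=
  Lan.subst t fun _ => s

theorem Lan.after_subst {v w : Word C} {a b : C} (t : O.Lan (Word.single a) b)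
    (s : O.Lan w a) (g : ∀ k, O.Lan v (w.get k)) :
    Lan.subst (Lan.after t s) g = Lan.after t (Lan.subst s g) :=
  Lan.subst_subst _ _ _

theorem Lan.after_after {w : Word C} {a b c : C} (t : O.Lan (Word.single b) c)
    (s : O.Lan (Word.single a) b) (r : O.Lan w a) :
    Lan.after (Lan.after t s) r = Lan.after t (Lan.after s r) :=
  Lan.subst_subst _ _ _

/-- The only variable, as an element of `p_! O`. -/
def Lan.var (O : SymOperad C) (a : C) : O.Lan (Word.single a) a :=
  Lan.proj O (Word.single a) (0 : Fin 1)

theorem Lan.var_after {w : Word C} {a : C} (s : O.Lan w a) : Lan.after (Lan.var O a) s = s :=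
  Lan.proj_subst (d := Word.single a) (0 : Fin 1) fun _ => s

theorem Lan.map_after (f : O.Hom P) {w : Word C} {a b : C} (t : O.Lan (Word.single a) b)
    (s : O.Lan w a) :
    Lan.map f (Lan.after t s) =
      Lan.after (w := w.map f.onColour) (a := f.onColour a) (Lan.map f t) (Lan.map f s) :=
  Lan.map_subst f t fun _ => s

theorem Lan.mk_single {a b : C} (α : Fin 1 → Fin 1) (o : O.Op (Word.single a) b) :
    Lan.mk (c := Word.single a) 1 α o = Lan.ofOp o :=
  congrArg (fun α : Fin 1 → Fin 1 => Lan.mk (c := Word.single a) 1 α o)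
    (funext fun _ => Subsingleton.elim (α := Fin 1) _ _)

theorem Lan.ofOp_comp₁ {a b c : C} (i : O.Op (Word.single a) b) (r : O.Op (Word.single b) c) :
    Lan.ofOp (O.comp₁ i r) = Lan.after (Lan.ofOp r) (Lan.ofOp i) := by
  refine Eq.trans ?_ (Lan.ofOp_subst (a := Word.single a) r (fun _ j => j) (fun _ => i)).symm
  exact (Lan.sound (c := Word.single a)
    (Word.Perm.joinSingle (Word.single a)).equiv (fun _ => rfl) rfl).symm

theorem Lan.arity_eq {w : Word C} {d : C} {m m' : ℕ} {α : Fin m → Fin w.len}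
    {α' : Fin m' → Fin w.len} {x : O.Op (w.reindex α) d} {x' : O.Op (w.reindex α') d}
    (e : Lan.mk m α x = Lan.mk m' α' x') : m = m' := by
  obtain ⟨σ, -, -⟩ := Quotient.exact e
  exact Fin.equiv_iff_eq.1 ⟨σ⟩

/-- A retract diagram between one-term sequences in the theory of `O` consists of unary
operations of `O`: the arities of the two morphisms multiply to `1`. -/
theorem Lan.exists_comp₁_eq_one {a b : C} (i : O.Lan (Word.single a) b)
    (r : O.Lan (Word.single b) a) (e : Lan.after r i = Lan.var O a) :
    ∃ (i' : O.Op (Word.single a) b) (r' : O.Op (Word.single b) a), O.comp₁ i' r' = O.one a := by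
  obtain ⟨n, α, x, rfl⟩ := Lan.ind i
  obtain ⟨m, β, y, rfl⟩ := Lan.ind r
  have h := Lan.arity_eq ((Lan.subst_mk (d := Word.single b) y
    (fun _ => Lan.mk (c := Word.single a) n α x) (fun _ => n) (fun _ => α) (fun _ => x)
    (fun _ => rfl)).symm.trans e)
  replace h : ∑ _ : Fin m, n = 1 := h
  rw [Finset.sum_const, Finset.card_univ, Fintype.card_fin, smul_eq_mul] at h
  obtain rfl : m = 1 := Nat.eq_one_of_mul_eq_one_right h
  obtain rfl : n = 1 := Nat.eq_one_of_mul_eq_one_left h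
  refine ⟨x, y, Lan.ofOp_injective ?_⟩
  refine (Lan.ofOp_comp₁ (a := a) (b := b) (c := a) x y).trans ?_
  rw [Lan.ofOp_one]
  refine Eq.trans ?_ e
  exact congrArg₂ Lan.after (Lan.mk_single (a := b) β y).symm (Lan.mk_single (a := a) α x).symm

/-- If the one-term sequence `a` is a retract of the sequence `v` in the theory of `O`, then the
colour `a` is a retract of an entry of `v` in the underlying category: exactly one variable is
used by the composite `a ⟶ v ⟶ a`, and the operations that are inserted for the other variables
of the retraction are nullary. -/
theorem Lan.exists_retract {a : C} {v : Word C} (g : ∀ k, O.Lan (Word.single a) (v.get k))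
    (t : O.Lan v a) (e : Lan.subst t g = Lan.var O a) :
    ∃ (k : Fin v.len) (i : O.Op (Word.single a) (v.get k))
      (r : O.Op (Word.single (v.get k)) a), O.comp₁ i r = O.one a := by
  obtain ⟨m, α, q, rfl⟩ := Lan.ind t
  choose n β x hg using fun k => Lan.ind (g (α k))
  have e' := (Lan.subst_mk q g n β x hg).symm.trans e
  obtain ⟨σ, -, -⟩ := Quotient.exact e'
  change Fin (Word.join fun k => (Word.single a).reindex (β k)).len ≃ Fin 1 at σ
  let s : (Σ k : Fin m, Fin (n k)) ≃ Fin 1 :=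
    (Word.split fun k => (Word.single a).reindex (β k)).symm.trans σ
  -- `p.1` is the position of the only variable of `q` that does not receive a nullary operation.
  let p := s.symm 0
  have unique : ∀ p' : Σ k : Fin m, Fin (n k), p' = p := fun p' =>
    s.injective (Subsingleton.elim _ _)
  -- The components of the inclusion factor through the component that is really used.
  have factor : ∀ k, ∃ h : O.Lan (Word.single (v.get (α p.1))) (v.get (α k)),
      Lan.subst h (fun _ => g (α p.1)) = g (α k) := by
    intro k
    by_cases hk : k = p.1
    · subst hk
      exact ⟨Lan.var O _, Lan.var_after _⟩
    · have empty : Fin (n k) → False := fun j => hk (congrArg Sigma.fst (unique ⟨k, j⟩))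
      refine ⟨Lan.subst (Lan.ofOp (x k)) fun j => (empty j).elim, ?_⟩
      rw [hg k]
      refine (Lan.subst_subst _ _ _).trans (Eq.trans ?_ (Lan.ofOp_subst_proj (β k) (x k)))
      exact congrArg (Lan.subst (Lan.ofOp (x k))) (funext fun j => (empty j).elim)
  choose h hh using factor
  refine ⟨α p.1, Lan.exists_comp₁_eq_one (g (α p.1)) (Lan.subst (Lan.ofOp q) h) ?_⟩
  refine (Lan.subst_subst (Lan.ofOp q) h _).trans ?_
  refine (congrArg (Lan.subst (Lan.ofOp q)) (funext hh)).trans (Eq.trans ?_ e)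
  rw [← Lan.ofOp_subst_proj α q]
  refine Eq.trans ?_ (Lan.subst_subst _ _ _).symm
  exact congrArg (Lan.subst (Lan.ofOp q)) (funext fun k => (Lan.proj_subst (α k) g).symm)

/-- A choice, for every colour `d` of the target, of a colour of the source whose image has `d`
as a retract, expressed in the theory. -/
structure Hom.Retraction (f : O.Hom P) where
  colour : D → C
  incl : ∀ d, P.Lan (Word.single d) (f.onColour (colour d))
  retr : ∀ d, P.Lan (Word.single (f.onColour (colour d))) d
  retr_incl : ∀ d, Lan.after (retr d) (incl d) = Lan.var P d

theorem Hom.nonempty_retraction {f : O.Hom P} (h : EssSurjUpToRetracts f.underlying) :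
    Nonempty f.Retraction := by
  choose c hc using h
  let R := fun d => (hc d).some
  exact ⟨{
    colour := c
    incl := fun d => Lan.ofOp (R d).i
    retr := fun d => Lan.ofOp (R d).r
    retr_incl := fun d => (Lan.ofOp_comp₁ (R d).i (R d).r).symm.trans
      ((congrArg Lan.ofOp (R d).retract).trans (Lan.ofOp_one d)) }⟩

theorem Hom.Retraction.essSurj_theoryFunctor {f : O.Hom P} (R : f.Retraction) :
    EssSurjUpToRetracts f.theoryFunctor := by
  refine fun w => ⟨O.ofWord (Word.map R.colour w), ⟨{
    i := fun k => Lan.after (R.incl (Word.get w k)) (Lan.proj P w k)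
    r := fun k => Lan.after (R.retr (Word.get w k))
      (Lan.proj P ((Word.map R.colour w).map f.onColour) k)
    retract := funext fun k => ?_ }⟩⟩
  refine (Lan.after_subst _ _ _).trans ?_
  refine (congrArg (Lan.after (R.retr (Word.get w k)))
    (Lan.proj_subst (d := (Word.map R.colour w).map f.onColour) k _)).trans ?_
  refine (Lan.after_after _ _ _).symm.trans ?_
  rw [R.retr_incl]
  exact Lan.var_after _

theorem Hom.essSurj_underlying_of_theory {f : O.Hom P}
    (h : EssSurjUpToRetracts f.theoryFunctor) : EssSurjUpToRetracts f.underlying := by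
  intro d
  obtain ⟨w, ⟨R⟩⟩ := h (P.ofWord (Word.single d))
  obtain ⟨k, i, r, e⟩ := Lan.exists_retract (v := Word.map f.onColour w) R.i (R.r (0 : Fin 1))
    (congrFun R.retract (0 : Fin 1))
  exact ⟨Word.get w k, ⟨⟨i, r, e⟩⟩⟩

theorem Hom.isMorita_iff_theoryHom (f : O.Hom P) : f.IsMorita ↔ f.theoryHom.IsMorita := by
  constructor
  · rintro ⟨h, hs⟩
    obtain ⟨R⟩ := Hom.nonempty_retraction hs
    exact ⟨h.lanBijective.full, h.lanBijective.faithful, R.essSurj_theoryFunctor⟩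
  · rintro ⟨h₁, h₂, hs⟩
    exact ⟨(f.lanBijective_of_theoryFunctor h₁ h₂).fullyFaithful,
      Hom.essSurj_underlying_of_theory hs⟩

/-! ### Restriction along a Morita equivalence -/

theorem Alg.isIso_of_bijective {X Y : O.Alg} (h : X ⟶ Y)
    (hh : ∀ c, Function.Bijective (Alg.Hom.app h c)) : IsIso h := by
  choose g hg₁ hg₂ using fun c => Function.bijective_iff_has_inverse.1 (hh c)
  refine ⟨⟨⟨g, fun {w d} o y => (hh d).1 ?_⟩, Alg.hom_ext hg₁, Alg.hom_ext hg₂⟩⟩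
  refine (hg₂ _ _).trans (Eq.trans ?_ (Alg.Hom.app_act h o _).symm)
  exact congrArg (Y.act o) (funext fun i => (hg₂ _ (y i)).symm)

/-- The action of an element of `p_! O` with a single variable. -/
def Alg.evalAt (X : O.Alg) {a b : C} (t : O.Lan (Word.single a) b) (x : X.carrier a) :
    X.carrier b :=
  X.eval t fun _ => x

theorem Alg.eval_after (X : O.Alg) {w : Word C} {a b : C} (t : O.Lan (Word.single a) b)
    (s : O.Lan w a) (x : ∀ i, X.carrier (w.get i)) :
    X.eval (Lan.after t s) x = X.evalAt t (X.eval s x) :=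
  X.eval_subst _ _ _

theorem Alg.evalAt_after (X : O.Alg) {a b c : C} (t : O.Lan (Word.single b) c)
    (s : O.Lan (Word.single a) b) (x : X.carrier a) :
    X.evalAt (Lan.after t s) x = X.evalAt t (X.evalAt s x) :=
  X.eval_subst _ _ _

theorem Alg.evalAt_var (X : O.Alg) {a : C} (x : X.carrier a) : X.evalAt (Lan.var O a) x = x :=
  X.eval_proj (Word.single a) (0 : Fin 1) fun _ => x

theorem Alg.evalAt_pullback (f : O.Hom P) (X : P.Alg) {a b : C} (t : O.Lan (Word.single a) b)
    (x : X.carrier (f.onColour a)) :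
    (f.pullback.obj X).evalAt t x =
      X.evalAt (a := f.onColour a) (b := f.onColour b) (Lan.map f t) x :=
  Alg.eval_pullback f X t fun _ => x

theorem Alg.app_evalAt {X Y : O.Alg} (h : X ⟶ Y) {a b : C} (t : O.Lan (Word.single a) b)
    (x : X.carrier a) : Alg.Hom.app h b (X.evalAt t x) = Y.evalAt t (Alg.Hom.app h a x) :=
  Alg.Hom.app_eval h t fun _ => x

namespace Hom

variable {f : O.Hom P}

/-- The inverse of the bijection `(p_! O)(w; d) ⟶ (p_! P)(f(w); f(d))`. -/
noncomputable def LanBijective.lift (hf : f.LanBijective) {w : Word C} {d : C}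
    (t : P.Lan (w.map f.onColour) (f.onColour d)) : O.Lan w d :=
  ((hf w d).2 t).choose

theorem LanBijective.map_lift (hf : f.LanBijective) {w : Word C} {d : C}
    (t : P.Lan (w.map f.onColour) (f.onColour d)) : Lan.map f (hf.lift t) = t :=
  ((hf w d).2 t).choose_spec

namespace Retraction

variable (R : f.Retraction) (hf : f.LanBijective)

/-- The retractions `f(c₁ ⋯ cₙ) ⟶ d₁ ⋯ dₙ` onto a sequence of colours, where `dᵢ` is a retract
of `f(cᵢ)`. -/
noncomputable def retrWord (v : Word D) (k : Fin v.len) :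
    P.Lan ((v.map R.colour).map f.onColour) (v.get k) :=
  Lan.after (R.retr (v.get k)) (Lan.proj P ((v.map R.colour).map f.onColour) k)

/-- The inclusions `d₁ ⋯ dₙ ⟶ f(c₁ ⋯ cₙ)` of a sequence of colours, where `dᵢ` is a retract
of `f(cᵢ)`. -/
noncomputable def inclWord (v : Word D) (k : Fin v.len) :
    P.Lan v (f.onColour (R.colour (v.get k))) :=
  Lan.after (R.incl (v.get k)) (Lan.proj P v k)

theorem retr_incl_after {w : Word D} {d : D} (t : P.Lan w d) :
    Lan.after (R.retr d) (Lan.after (R.incl d) t) = t := by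
  rw [← Lan.after_after, R.retr_incl, Lan.var_after]

theorem retrWord_subst {v w : Word D} (k : Fin v.len)
    (g : ∀ k, P.Lan w (((v.map R.colour).map f.onColour).get k)) :
    Lan.subst (R.retrWord v k) g = Lan.after (R.retr (v.get k)) (g k) :=
  (Lan.after_subst _ _ _).trans (congrArg (Lan.after _)
    (Lan.proj_subst (d := (v.map R.colour).map f.onColour) k g))

/-- The composite `c₁ ⋯ cₙ ⟶ c` in the theory of `O` that corresponds to
`f(c₁ ⋯ cₙ) ⟶ d₁ ⋯ dₙ ⟶ d ⟶ f(c)`. -/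
noncomputable def conj {v : Word D} {d : D} (t : P.Lan v d) :
    O.Lan (v.map R.colour) (R.colour d) :=
  hf.lift (Lan.after (R.incl d) (Lan.subst t (R.retrWord v)))

theorem map_conj {v : Word D} {d : D} (t : P.Lan v d) :
    Lan.map f (R.conj hf t) = Lan.after (R.incl d) (Lan.subst t (R.retrWord v)) :=
  hf.map_lift _

theorem conj_subst {v w : Word D} {d : D} (t : P.Lan v d) (g : ∀ k, P.Lan w (v.get k)) :
    R.conj hf (Lan.subst t g) =
      Lan.subst (d := v.map R.colour) (R.conj hf t) fun k => R.conj hf (g k) := by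
  refine (hf _ _).1 (Eq.trans ?_ (Lan.map_subst f _ _).symm)
  rw [map_conj, map_conj, Lan.subst_subst]
  refine Eq.trans ?_ (Lan.after_subst _ _ _).symm
  refine congrArg (Lan.after _) (Eq.trans ?_ (Lan.subst_subst _ _ _).symm)
  refine congrArg (Lan.subst t) (funext fun k => Eq.trans ?_ (R.retrWord_subst k _).symm)
  exact ((congrArg (Lan.after _) (R.map_conj hf (g k))).trans (R.retr_incl_after _)).symm

/-- The idempotent on a colour of `O` that corresponds to the retract of its image. -/
noncomputable def idem (d : D) : O.Lan (Word.single (R.colour d)) (R.colour d) :=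
  hf.lift (w := Word.single (R.colour d)) (Lan.after (R.incl d) (R.retr d))

theorem map_idem (d : D) : Lan.map f (R.idem hf d) = Lan.after (R.incl d) (R.retr d) :=
  hf.map_lift _

theorem conj_proj (v : Word D) (k : Fin v.len) :
    R.conj hf (Lan.proj P v k) =
      Lan.after (R.idem hf (v.get k)) (Lan.proj O (v.map R.colour) k) := by
  refine (hf _ _).1 (Eq.trans ?_ (Lan.map_after f _ _).symm)
  rw [map_conj, Lan.proj_subst, map_idem]
  refine (Lan.after_after _ _ _).symm.trans (congrArg (Lan.after _) ?_)
  exact (Lan.map_proj f (v.map R.colour) k).symm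

theorem idem_conj {v : Word D} {d : D} (t : P.Lan v d) :
    Lan.after (R.idem hf d) (R.conj hf t) = R.conj hf t := by
  refine (hf _ _).1 ((Lan.map_after f _ _).trans ?_)
  rw [map_idem, map_conj, Lan.after_after, R.retr_incl_after]

theorem retr_map_conj {v : Word D} {d : D} (t : P.Lan v d) :
    Lan.after (R.retr d) (Lan.map f (R.conj hf t)) = Lan.subst t (R.retrWord v) := by
  rw [map_conj, R.retr_incl_after]

theorem map_conj_inclWord {v : Word D} {d : D} (t : P.Lan v d) :
    Lan.subst (d := (v.map R.colour).map f.onColour) (Lan.map f (R.conj hf t)) (R.inclWord v) =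
      Lan.after (R.incl d) t := by
  rw [map_conj]
  refine (Lan.after_subst _ _ _).trans (congrArg (Lan.after _) ?_)
  refine (Lan.subst_subst _ _ _).trans (Eq.trans ?_ (Lan.subst_proj t))
  refine congrArg (Lan.subst t) (funext fun k => ?_)
  exact (R.retrWord_subst k _).trans (R.retr_incl_after _)

/-- Restriction is faithful, because every colour is a retract of one in the image. -/
theorem pullback_faithful (R : f.Retraction) : f.pullback.Faithful where
  map_injective {Y Z} g h e := by
    refine Alg.hom_ext fun d y => ?_
    have key : ∀ k : Y ⟶ Z, Alg.Hom.app k d y =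
        Z.evalAt (R.retr d) (Alg.Hom.app k _ (Y.evalAt (R.incl d) y)) := by
      intro k
      rw [← Alg.app_evalAt, ← Alg.evalAt_after, R.retr_incl, Alg.evalAt_var]
    rw [key g, key h]
    exact congrArg (Z.evalAt _) (congrFun (congrFun (congrArg Alg.Hom.app e) (R.colour d)) _)

/-- The extension of a morphism `f^* Y ⟶ f^* Z` to all colours of `P`. -/
noncomputable def extendHom {Y Z : P.Alg} (h : f.pullback.obj Y ⟶ f.pullback.obj Z) : Y ⟶ Z where
  app d y := Z.evalAt (R.retr d) (Alg.Hom.app h (R.colour d) (Y.evalAt (R.incl d) y))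
  app_act {v d} p y := by
    rw [← Y.eval_ofOp, ← Y.eval_after, ← R.map_conj_inclWord hf]
    refine (congrArg (fun z => Z.evalAt _ (Alg.Hom.app h (R.colour d) z))
      ((Y.eval_subst _ _ _).trans (Alg.eval_pullback f Y _ _).symm)).trans ?_
    refine (congrArg (Z.evalAt _) ((Alg.Hom.app_eval h _ _).trans
      (Alg.eval_pullback f Z _ _))).trans ?_
    refine (Z.eval_after _ _ _).symm.trans ?_
    rw [retr_map_conj]
    refine (Z.eval_subst _ _ _).trans ?_
    refine congrArg (Z.act p) (funext fun k => ?_)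
    refine (Z.eval_after _ _ _).trans (congrArg (Z.evalAt _) ?_)
    refine (Z.eval_proj ((v.map R.colour).map f.onColour) k _).trans
      (congrArg (Alg.Hom.app h _) ?_)
    exact (Y.eval_after _ _ _).trans (congrArg (Y.evalAt _) (Y.eval_proj _ _ _))

theorem pullback_full (R : f.Retraction) (hf : f.LanBijective) : f.pullback.Full where
  map_surjective {Y Z} h := by
    refine ⟨R.extendHom hf h, Alg.hom_ext fun c y => ?_⟩
    change Z.evalAt (R.retr (f.onColour c))
      (Alg.Hom.app h _ (Y.evalAt (R.incl (f.onColour c)) y)) = _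
    have e := hf.map_lift (w := Word.single c) (R.incl (f.onColour c))
    rw [← e]
    refine (congrArg (fun z => Z.evalAt _ (Alg.Hom.app h _ z))
      (Alg.evalAt_pullback f Y _ y).symm).trans ?_
    refine (congrArg (Z.evalAt _) ((Alg.app_evalAt h _ y).trans
      (Alg.evalAt_pullback f Z _ _))).trans ?_
    rw [e]
    refine (Z.evalAt_after _ _ _).symm.trans ?_
    rw [R.retr_incl]
    exact Z.evalAt_var _

/-- The extension of an `O`-algebra `X` to a `P`-algebra: its value at a retract `d` of `f(c)`
consists of the elements of `X_c` that are fixed by the corresponding idempotent. -/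
noncomputable def extendAlg (X : O.Alg) : P.Alg :=
  Alg.ofEval (fun d => {x : X.carrier (R.colour d) // X.evalAt (R.idem hf d) x = x})
    (fun {w _} t y => ⟨X.eval (w := w.map R.colour) (R.conj hf t) fun i => (y i).1, 
      (X.eval_after _ _ _).symm.trans (congrArg (fun s => X.eval s _) (R.idem_conj hf t))⟩)
    (fun w i y => Subtype.ext (by
      refine (congrArg (fun t => X.eval (w := w.map R.colour) t fun i => (y i).1)
        (R.conj_proj hf w i)).trans ?_
      refine (X.eval_after _ _ _).trans ?_
      exact (congrArg (X.evalAt _) (X.eval_proj (w.map R.colour) i _)).trans (y i).2))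
    (fun {w v _} t g y => Subtype.ext (by
      refine (congrArg (fun t => X.eval (w := v.map R.colour) t fun i => (y i).1)
        (R.conj_subst hf t g)).trans ?_
      exact X.eval_subst _ _ _))

/-- The element of `p_! O` with a single variable that corresponds to the inclusion
`f(c) ⟶ f(c')`, where `c'` is the colour that is chosen for `f(c)`. -/
noncomputable def liftIncl (c : C) : O.Lan (Word.single c) (R.colour (f.onColour c)) :=
  hf.lift (w := Word.single c) (R.incl (f.onColour c))

/-- The element of `p_! O` with a single variable that corresponds to the retraction
`f(c') ⟶ f(c)`, where `c'` is the colour that is chosen for `f(c)`. -/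
noncomputable def liftRetr (c : C) : O.Lan (Word.single (R.colour (f.onColour c))) c :=
  hf.lift (w := Word.single (R.colour (f.onColour c))) (R.retr (f.onColour c))

theorem map_liftIncl (c : C) : Lan.map f (R.liftIncl hf c) = R.incl (f.onColour c) :=
  hf.map_lift _

theorem map_liftRetr (c : C) : Lan.map f (R.liftRetr hf c) = R.retr (f.onColour c) :=
  hf.map_lift _

theorem liftRetr_liftIncl (c : C) :
    Lan.after (R.liftRetr hf c) (R.liftIncl hf c) = Lan.var O c := by
  refine (hf _ _).1 ((Lan.map_after f _ _).trans ?_)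
  rw [map_liftIncl, map_liftRetr]
  exact (R.retr_incl _).trans (Lan.map_proj f (Word.single c) (0 : Fin 1)).symm

theorem liftIncl_liftRetr (c : C) :
    Lan.after (R.liftIncl hf c) (R.liftRetr hf c) = R.idem hf (f.onColour c) := by
  refine (hf _ _).1 ((Lan.map_after f _ _).trans ?_)
  rw [map_liftIncl, map_liftRetr, map_idem]
  rfl

/-- The map `X_c ⟶ X_{c'}` onto the elements fixed by the idempotent of `f(c)`, where `c'` is the
colour that is chosen for `f(c)`. -/
noncomputable def extendAlgUnit (X : O.Alg) : X ⟶ f.pullback.obj (R.extendAlg hf X) where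
  app c x := ⟨X.evalAt (R.liftIncl hf c) x, by
    rw [← R.liftIncl_liftRetr hf, Alg.evalAt_after, ← X.evalAt_after (R.liftRetr hf c),
      liftRetr_liftIncl, Alg.evalAt_var]⟩
  app_act {w d} o x := Subtype.ext (by
    refine (X.eval_after _ (Lan.ofOp o) x).symm.trans ?_
    have e : Lan.after (R.liftIncl hf d) (Lan.ofOp o) =
        Lan.subst (d := (w.map f.onColour).map R.colour)
          (R.conj hf (Lan.ofOp (f.onOp o))) fun k =>
            Lan.after (R.liftIncl hf (w.get k)) (Lan.proj O w k) := by
      refine (hf _ _).1 ((Lan.map_after f _ _).trans (Eq.trans ?_ (Lan.map_subst f _ _).symm))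
      rw [map_liftIncl]
      refine (R.map_conj_inclWord hf (Lan.ofOp (f.onOp o))).symm.trans ?_
      refine congrArg (Lan.subst _) (funext fun k => ?_)
      refine Eq.trans ?_ (Lan.map_after f _ _).symm
      exact (congrArg₂ Lan.after (R.map_liftIncl hf (w.get k)) (Lan.map_proj f w k)).symm
    rw [e]
    refine (X.eval_subst _ _ _).trans ?_
    change _ = X.eval (w := (w.map f.onColour).map R.colour) (R.conj hf (Lan.ofOp (f.onOp o)))
      fun k => X.evalAt (R.liftIncl hf (w.get k)) (x k)
    refine congrArg (X.eval (w := (w.map f.onColour).map R.colour) _) (funext fun k => ?_)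
    exact (X.eval_after _ _ _).trans (congrArg (X.evalAt _) (X.eval_proj _ _ _)))

theorem bijective_extendAlgUnit (X : O.Alg) (c : C) :
    Function.Bijective (Alg.Hom.app (R.extendAlgUnit hf X) c) := by
  refine Function.bijective_iff_has_inverse.2
    ⟨fun y => X.evalAt (R.liftRetr hf c) y.1, fun x => ?_, fun y => ?_⟩
  · refine (X.evalAt_after _ _ x).symm.trans ?_
    rw [liftRetr_liftIncl, Alg.evalAt_var]
  · refine Subtype.ext ((X.evalAt_after _ _ y.1).symm.trans ?_)
    rw [liftIncl_liftRetr]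
    exact y.2

theorem pullback_isEquivalence (R : f.Retraction) (hf : f.LanBijective) :
    f.pullback.IsEquivalence where
  faithful := R.pullback_faithful
  full := R.pullback_full hf
  essSurj := ⟨fun X => by
    have := Alg.isIso_of_bijective _ (R.bijective_extendAlgUnit hf X)
    exact ⟨R.extendAlg hf X, ⟨(asIso (R.extendAlgUnit hf X)).symm⟩⟩⟩

end Retraction

end Hom

/-! ### Recovering the theory from the algebras -/

namespace Hom

variable (f : O.Hom P)

/-- The elements of a `P`-algebra that are values of operations of the theory of `P` on elements
whose colours are in the image of `f`. -/
def InImage (Y : P.Alg) {d : D} (y : Y.carrier d) : Prop :=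
  ∃ (w : Word C) (t : P.Lan (w.map f.onColour) d)
    (x : ∀ i, Y.carrier ((w.map f.onColour).get i)), Y.eval t x = y

theorem inImage_colour (Y : P.Alg) {c : C} (y : Y.carrier (f.onColour c)) : f.InImage Y y :=
  ⟨Word.single c, Lan.var P (f.onColour c), fun _ => y, Y.evalAt_var y⟩

theorem inImage_eval (Y : P.Alg) {v : Word D} {d : D} (t : P.Lan v d)
    (y : ∀ i, Y.carrier (v.get i)) (hy : ∀ i, f.InImage Y (y i)) :
    f.InImage Y (Y.eval t y) := by
  choose w s x hx using hy
  refine ⟨Word.join w, Lan.subst t fun i =>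
    Lan.subst (s i) (Lan.block P (fun i => (w i).map f.onColour) i),
    fun k => x (Word.split w k).1 (Word.split w k).2, ?_⟩
  refine (Y.eval_subst _ _ _).trans (congrArg (Y.eval t) (funext fun i => ?_))
  refine (Y.eval_subst _ _ _).trans (Eq.trans ?_ (hx i))
  exact congrArg (Y.eval (s i)) (funext fun j =>
    Alg.eval_block Y (fun i => (w i).map f.onColour) x i j)

/-- The subalgebra of a `P`-algebra that is generated by the colours in the image of `f`. -/
def imageAlg (Y : P.Alg) : P.Alg where
  carrier d := {y : Y.carrier d // f.InImage Y y}
  act p y := ⟨Y.act p fun i => (y i).1, f.inImage_eval Y (Lan.ofOp p) _ fun i => (y i).2⟩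
  act_one y := Subtype.ext (Y.act_one y.1)
  act_comp p _ q y := Subtype.ext (Y.act_comp p q fun i j => (y i j).1)
  act_perm σ p y := Subtype.ext (Y.act_perm σ p fun i => (y i).1)

/-- The inclusion of the subalgebra that is generated by the colours in the image of `f`. -/
def imageAlgIncl (Y : P.Alg) : f.imageAlg Y ⟶ Y where
  app _ y := y.1
  app_act _ _ := rfl

theorem isIso_pullback_imageAlgIncl (Y : P.Alg) : IsIso (f.pullback.map (f.imageAlgIncl Y)) :=
  Alg.isIso_of_bijective _ fun _ =>
    ⟨fun _ _ e => Subtype.ext e, fun y => ⟨⟨y, f.inImage_colour Y y⟩, rfl⟩⟩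

/-- If restriction reflects isomorphisms, then every `P`-algebra is generated by its elements
whose colours are in the image of `f`. -/
theorem inImage_of_reflectsIsomorphisms [f.pullback.ReflectsIsomorphisms] (Y : P.Alg) {d : D}
    (y : Y.carrier d) : f.InImage Y y := by
  have := f.isIso_pullback_imageAlgIncl Y
  have := isIso_of_reflects_iso (f.imageAlgIncl Y) f.pullback
  obtain ⟨y', rfl⟩ := (Alg.bijective_of_isIso (f.imageAlgIncl Y) d).2 y
  exact y'.2

/-- The generator of a free algebra on a colour `d` is generated by colours in the image of `f`;
this says that `d` is a retract, in the theory of `P`, of a sequence in the image. -/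
theorem essSurj_underlying_of_reflectsIsomorphisms [f.pullback.ReflectsIsomorphisms] :
    EssSurjUpToRetracts f.underlying := by
  intro d
  obtain ⟨w, t, g, e⟩ :=
    f.inImage_of_reflectsIsomorphisms (Alg.free P (Word.single d)) (Lan.var P d)
  obtain ⟨k, i, r, h⟩ := Lan.exists_retract (v := w.map f.onColour) g t
    ((Alg.eval_free t g).symm.trans e)
  exact ⟨w.get k, ⟨⟨i, r, h⟩⟩⟩

/-- The morphism between free algebras that is given by `p_! f`. -/
def freeMap (w : Word C) :
    Alg.free O w ⟶ f.pullback.obj (Alg.free P (w.map f.onColour)) where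
  app _ t := Lan.map f t
  app_act o g := Lan.map_subst f (Lan.ofOp o) g

/-- The left adjoint `f_!` sends the free algebra on `w` to the free algebra on `f(w)`, and the
unit corresponds to `p_! f`. Hence `p_! f` is bijective if the unit is an isomorphism. -/
theorem lanBijective_of_isIso_unit {F : O.Alg ⥤ P.Alg} (adj : F ⊣ f.pullback)
    [IsIso adj.unit] : f.LanBijective := by
  intro w
  let G := Alg.free P (w.map f.onColour)
  let η := adj.unit.app (Alg.free O w)
  let h : F.obj (Alg.free O w) ⟶ G := (adj.homEquiv _ _).symm (f.freeMap w)
  let k : G ⟶ F.obj (Alg.free O w) :=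
    Alg.freeDesc (w := w.map f.onColour) _ fun i => Alg.Hom.app η _ (Lan.proj O w i)
  have hη : η ≫ f.pullback.map h = f.freeMap w :=
    (adj.homEquiv_unit _ _ _).symm.trans ((adj.homEquiv _ _).apply_symm_apply _)
  have app_hη : ∀ i : Fin w.len,
      Alg.Hom.app h _ (Alg.Hom.app η _ (Lan.proj O w i)) =
        Lan.proj P (w.map f.onColour) i := fun i =>
    (congrFun (congrFun (congrArg Alg.Hom.app hη) _) (Lan.proj O w i)).trans
      (Lan.map_proj f w i)
  have app_k : ∀ i : Fin w.len, Alg.Hom.app k _ (Lan.proj P (w.map f.onColour) i) =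
      Alg.Hom.app η _ (Lan.proj O w i) := fun i =>
    Alg.freeDesc_proj (w := w.map f.onColour) _ _ i
  have hk : f.freeMap w ≫ f.pullback.map k = η := Alg.free_hom_ext fun i =>
    (congrArg (Alg.Hom.app k _) (Lan.map_proj f w i)).trans (app_k i)
  have h₁ : h ≫ k = 𝟙 _ := (adj.homEquiv _ _).injective (by
    rw [adj.homEquiv_unit, adj.homEquiv_unit, Functor.map_comp, CategoryTheory.Functor.map_id]
    exact (Category.assoc _ _ _).symm.trans ((congrArg (· ≫ f.pullback.map k) hη).trans
      (hk.trans (Category.comp_id _).symm)))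
  have h₂ : k ≫ h = 𝟙 _ := Alg.free_hom_ext (w := w.map f.onColour) fun i =>
    (congrArg (Alg.Hom.app h _) (app_k i)).trans (app_hη i)
  have : IsIso h := ⟨⟨k, h₁, h₂⟩⟩
  have : IsIso (f.freeMap w) := hη ▸ inferInstance
  exact fun d => Alg.bijective_of_isIso (f.freeMap w) d

theorem isMorita_of_isIso {F : O.Alg ⥤ P.Alg} (adj : F ⊣ f.pullback) (h₁ : IsIso adj.unit)
    (h₂ : IsIso adj.counit) : f.IsMorita := by
  have : f.pullback.IsEquivalence := adj.toEquivalence.isEquivalence_inverse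
  exact ⟨(f.lanBijective_of_isIso_unit adj).fullyFaithful,
    f.essSurj_underlying_of_reflectsIsomorphisms⟩

theorem IsMorita.pullback_isEquivalence {f : O.Hom P} (h : f.IsMorita) :
    f.pullback.IsEquivalence :=
  (nonempty_retraction h.2).some.pullback_isEquivalence h.1.lanBijective

end Hom

end SymOperad

end ColouredOperad

theorem mainTheorem5 {C D : Type u} {O : ColouredOperad.SymOperad C}
    {P : ColouredOperad.SymOperad D} (f : O.Hom P) :
    f.pullback.IsRightAdjoint ∧
      ∀ (extension : O.Alg ⥤ P.Alg) (adj : extension ⊣ f.pullback),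
        List.TFAE [f.IsMorita, f.theoryHom.IsMorita, IsIso adj.unit ∧ IsIso adj.counit] := by
  refine ⟨f.pullback_isRightAdjoint, fun F adj => ?_⟩
  tfae_have 1 ↔ 2 := f.isMorita_iff_theoryHom
  tfae_have 1 → 3 := fun h => by
    have := h.pullback_isEquivalence
    exact ⟨inferInstance, inferInstance⟩
  tfae_have 3 → 1 := fun h => f.isMorita_of_isIso adj h.1 h.2
  tfae_finish
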